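/- Let $d\in\{2,3\}$ and let $\Omega\subset\mathbb R^d$ be a nonempty bounded open set (no regularity of the boundary is needed). $H^1(\Omega)$ is the space of functions in $L^2(\Omega)$ with weak first derivatives in $L^2(\Omega)$, $H^1_0(\Omega)^d$ is the closure of $C_c^\infty(\Omega)^d$ in $H^1(\Omega)^d$, $\|\nabla u\|:=\big(\sum_{i}\|D_iu\|_{L^2(\Omega)}^2\big)^{1/2}$, $\|u\|_{H^1}^2:=\|u\|_{L^2}^2+\|\nabla u\|^2$, and $$K_\Omega:=\tfrac12|\Omega|^{1/2}\ (d=2),\qquad K_\Omega:=\tfrac{2\sqrt2}{3}|\Omega|^{1/6}\ (d=3).$$ A Poincaré constant is a number $C_p>0$ with $\|w\|_{L^2}\le C_p\|\nabla w\|$ for all $w\in H^1_0(\Omega)^d$. Put $(g,h):=\int_\Omega g\cdot h$, $a(u,w):=\mu\int_\Omega Du:Dw$ and $b(u,v,w):=\int_\Omega (u\cdot\nabla)v\cdot w$. Let $\mu,\alpha_0>0$, $f\in L^2(\Omega)^d$ and $\alpha:\mathbb R\to[0,\alpha_0]$. For $\varphi\in H^1(\Omega)\cap L^\infty(\Omega)$,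 a state solution for $\varphi$ is a pair $(u,p)\in H^1_0(\Omega)^d\times L^2(\Omega)$ with $$a(u,w)+b(u,u,w)+(\alpha(\varphi)u,w)-(p,\nabla\cdot w)=(f,w)\quad\forall w\in H^1_0(\Omega)^d,\qquad (\nabla\cdot u,r)=0\quad\forall r\in L^2(\Omega).$$ An adjoint solution for $(\varphi,u)$ (for the energy dissipation functional) is a pair $(v,q)\in H^1_0(\Omega)^d\times L^2(\Omega)$ with $$a(v,w)+b(w,u,v)+b(u,w,v)+(\alpha(\varphi)v,w)-(q,\nabla\cdot w)=a(u,w)+(\alpha(\varphi)u,w)\quad\forall w\in H^1_0(\Omega)^d,$$ and $(r,\nabla\cdot v)=0$ for all $r\in L^2(\Omega)$. **Lemma.** Poincaré constants of $\Omega$ exist. For all $\mu,\alpha_0>0$ and $f\in L^2(\Omega)^d$ there are constants $\mathcal C_1,\mathcal C_2>0$, depending only on $\mu,\alpha_0,f,\Omega$, such that the following holds for every $\alpha:\mathbb R\to[0,\alpha_0]$, every $\gamma>0$ with $$\|\alpha(\psi)-\alpha(\varphi)\|_{L^2(\Omega)}\le\gamma\|\psi-\varphi\|_{L^2(\Omega)}\qquad\forall\varphi,\psi\in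 H^1(\Omega)\cap L^\infty(\Omega),$$ and every Poincaré constant $C_p$. Let $\varphi^n,\varphi^{n+1}\in H^1(\Omega)\cap L^\infty(\Omega)$, and let $(u^n,p^n)$, $(u^{n+1},p^{n+1})$ be state solutions for $\varphi^n$, $\varphi^{n+1}$ with $\|\nabla u^n\|,\|\nabla u^{n+1}\|\le\frac{\mu}{2K_\Omega}$. Then $\|u^n\|_{H^1},\|u^{n+1}\|_{H^1}\le\mathcal C_1$ and $$\|\nabla(u^{n+1}-u^n)\|\le\tilde C_1\|\varphi^{n+1}-\varphi^n\|_{L^2(\Omega)},\qquad \tilde C_1:=\frac{\gamma(1+C_p)^2}{K_\Omega}.$$ If moreover $(v^n,q^n)$, $(v^{n+1},q^{n+1})$ are adjoint solutions for $(\varphi^n,u^n)$, $(\varphi^{n+1},u^{n+1})$, then $\|v^n\|_{H^1},\|v^{n+1}\|_{H^1}\le\mathcal C_2$ and $$\|\nabla(v^{n+1}-v^n)\|\le\tilde C_2\|\varphi^{n+1}-\varphi^n\|_{L^2(\Omega)},$$ $$\tilde C_2:=\max\big\{2K_\Omega\tilde C_1\mathcal C_2,\ \gamma(1+C_p)^2(\mathcal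 C_1+\mathcal C_2),\ \alpha_0C_p^2\tilde C_1+\mu\tilde C_1\big\}.$$ Furthermore, for arbitrary upper bounds $B_1\ge\|\nabla u^{n+1}\|$ and $B_2\ge\|\nabla v^{n+1}\|$, $$\|\nabla(v^{n+1}-v^n)\|\le\frac2\mu\Big(2K_\Omega\tilde C_1B_2+\gamma(1+C_p)^2(B_1+B_2)+\alpha_0C_p^2\tilde C_1+\mu\tilde C_1\Big)\|\varphi^{n+1}-\varphi^n\|_{L^2(\Omega)}.$$ -/

import Mathlib

open MeasureTheory Filter Topology
open scoped ContDiff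

noncomputable section

namespace PhaseFlow

/-- Euclidean space `ℝ^d`, with its Euclidean norm and Lebesgue measure. -/
abbrev E (d : ℕ) : Type := EuclideanSpace ℝ (Fin d)

section Sobolev

variable {d : ℕ} {F : Type} [NormedAddCommGroup F] [NormedSpace ℝ F]

/-- The classical partial derivative `∂ψ/∂x_i`. -/
def classicalPartial (i : Fin d) (ψ : E d → F) (x : E d) : F :=
  fderiv ℝ ψ x (EuclideanSpace.single i 1)

/-- `C_c^∞(Ω)` functions, extended by zero. -/
structure IsTestFunction (Ω : Set (E d)) (ψ : E d → F) : Prop where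
  smooth : ContDiff ℝ ∞ ψ
  compact : HasCompactSupport ψ
  support : tsupport ψ ⊆ Ω

/-- `g` is the generalized (weak) derivative of `u` with respect to `x_i` in `Ω`. -/
def IsWeakPartial (Ω : Set (E d)) (i : Fin d) (u g : E d → F) : Prop :=
  ∀ ψ : E d → ℝ, IsTestFunction Ω ψ →
    ∫ x in Ω, classicalPartial i ψ x • u x = -∫ x in Ω, ψ x • g x

/-- Elements of `H^1(Ω) = W^{1,2}(Ω)` with values in `F`: a square-integrable function `val` on `Ω`
together with its generalized partial derivatives `D_i val`, which are square-integrable.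
(These derivatives are determined by `val` almost everywhere in `Ω`; values off `Ω` play no role.) -/
structure H1 (Ω : Set (E d)) (F : Type) [NormedAddCommGroup F] [NormedSpace ℝ F] where
  val : E d → F
  D : Fin d → E d → F
  memLp_val : MemLp val 2 (volume.restrict Ω)
  memLp_D : ∀ i, MemLp (D i) 2 (volume.restrict Ω)
  isWeakPartial : ∀ i, IsWeakPartial Ω i val (D i)

/-- The `L^2(Ω)` norm. -/
def l2norm (Ω : Set (E d)) (g : E d → F) : ℝ :=
  (eLpNorm g 2 (volume.restrict Ω)).toReal

lemma IsTestFunction.integrable_smul {Ω : Set (E d)} {ψ : E d → ℝ} (hc : Continuous ψ)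
    (hs : HasCompactSupport ψ) {u : E d → F} (hu : MemLp u 2 (volume.restrict Ω)) :
    Integrable (fun x => ψ x • u x) (volume.restrict Ω) := by
  have h1 : MemLp ψ 2 (volume.restrict Ω) :=
    (hc.memLp_of_hasCompactSupport hs).restrict Ω
  exact memLp_one_iff_integrable.1 (hu.smul h1)

lemma IsTestFunction.partial_cont {Ω : Set (E d)} {ψ : E d → ℝ} (hψ : IsTestFunction Ω ψ)
    (i : Fin d) :
    Continuous (classicalPartial i ψ) ∧ HasCompactSupport (classicalPartial i ψ) := by
  refine ⟨?_, ?_⟩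
  · exact (hψ.smooth.continuous_fderiv (by simp)).clm_apply continuous_const
  · exact hψ.compact.fderiv_apply (𝕜 := ℝ) _

/-- The difference of two elements of `H^1(Ω)`. -/
instance (Ω : Set (E d)) : Sub (H1 Ω F) where
  sub u v :=
    { val := fun x => u.val x - v.val x
      D := fun i x => u.D i x - v.D i x
      memLp_val := u.memLp_val.sub v.memLp_val
      memLp_D := fun i => (u.memLp_D i).sub (v.memLp_D i)
      isWeakPartial := by
        intro i ψ hψ
        obtain ⟨h1, h2⟩ := hψ.partial_cont i
        have hc := hψ.smooth.continuous
        simp only [smul_sub]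
        rw [integral_sub (IsTestFunction.integrable_smul h1 h2 u.memLp_val)
            (IsTestFunction.integrable_smul h1 h2 v.memLp_val),
          integral_sub (IsTestFunction.integrable_smul hc hψ.compact (u.memLp_D i))
            (IsTestFunction.integrable_smul hc hψ.compact (v.memLp_D i)),
          u.isWeakPartial i ψ hψ, v.isWeakPartial i ψ hψ]
        abel }

/-- The `L^2(Ω)` norm `‖∇u‖ = (∑_i ‖D_i u‖²)^{1/2}` of the full gradient. -/
def H1.gradNorm {Ω : Set (E d)} (u : H1 Ω F) : ℝ :=
  √(∑ i, l2norm Ω (u.D i) ^ 2)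

/-- The `H^1(Ω)` norm. -/
def H1.norm {Ω : Set (E d)} (u : H1 Ω F) : ℝ :=
  √(l2norm Ω u.val ^ 2 + u.gradNorm ^ 2)

/-- `u ∈ H^1_0(Ω)`: `u` is a limit in `H^1(Ω)` of a sequence of `C_c^∞(Ω)` functions. -/
def H1.IsZeroBoundary {Ω : Set (E d)} (u : H1 Ω F) : Prop :=
  ∃ ψ : ℕ → E d → F, (∀ n, IsTestFunction Ω (ψ n)) ∧
    Tendsto (fun n => eLpNorm (fun x => ψ n x - u.val x) 2 (volume.restrict Ω)) atTop (𝓝 0) ∧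
    ∀ i, Tendsto (fun n => eLpNorm (fun x => classicalPartial i (ψ n) x - u.D i x) 2
      (volume.restrict Ω)) atTop (𝓝 0)

end Sobolev

section Flow

variable {d : ℕ} {Ω : Set (E d)}

/-- `a(u,v) = μ ∫_Ω Du : Dv`. -/
def viscousForm (μ : ℝ) (u v : H1 Ω (E d)) : ℝ :=
  μ * ∫ x in Ω, ∑ i, inner ℝ (u.D i x) (v.D i x)

/-- `b(u,v,w) = ∫_Ω (u·∇)v · w`. -/
def trilinearForm (u v w : H1 Ω (E d)) : ℝ :=
  ∫ x in Ω, inner ℝ (∑ j, (u.val x) j • v.D j x) (w.val x)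

/-- `(α(φ)u, v)`. -/
def porousForm (α : ℝ → ℝ) (φ : H1 Ω ℝ) (u v : H1 Ω (E d)) : ℝ :=
  ∫ x in Ω, α (φ.val x) * inner ℝ (u.val x) (v.val x)

/-- `∇·u`. -/
def H1.div (u : H1 Ω (E d)) (x : E d) : ℝ := ∑ i, (u.D i x) i

/-- `(u, p)` is a weak solution, for the phase field `φ`, of the stationary Navier–Stokes equations
with porous medium term and homogeneous Dirichlet boundary condition. -/
structure IsStateSolution (μ : ℝ) (f : E d → E d) (α : ℝ → ℝ) (φ : H1 Ω ℝ)
    (u : H1 Ω (E d)) (p : E d → ℝ) : Prop where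
  boundary : u.IsZeroBoundary
  pressure : MemLp p 2 (volume.restrict Ω)
  momentum : ∀ w : H1 Ω (E d), w.IsZeroBoundary →
    viscousForm μ u w + trilinearForm u u w + porousForm α φ u w - ∫ x in Ω, p x * w.div x
      = ∫ x in Ω, inner ℝ (f x) (w.val x)
  continuity : ∀ r : E d → ℝ, MemLp r 2 (volume.restrict Ω) → ∫ x in Ω, u.div x * r x = 0

/-- `(v, q)` is a weak solution of the adjoint equations at the state `u` with phase field `φ`, for
the energy dissipation `∫_Ω (μ/2)|Du|² + (1/2)α(φ)|u|²`, whose derivative in `u` in the direction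
`w` is `μ(Du, Dw) + (α(φ)u, w)`. -/
structure IsAdjointSolution (μ : ℝ) (α : ℝ → ℝ) (φ : H1 Ω ℝ) (u : H1 Ω (E d))
    (v : H1 Ω (E d)) (q : E d → ℝ) : Prop where
  boundary : v.IsZeroBoundary
  pressure : MemLp q 2 (volume.restrict Ω)
  momentum : ∀ w : H1 Ω (E d), w.IsZeroBoundary →
    viscousForm μ v w + trilinearForm w u v + trilinearForm u w v + porousForm α φ v w
        - ∫ x in Ω, q x * w.div x
      = viscousForm μ u w + porousForm α φ u w
  continuity : ∀ r : E d → ℝ, MemLp r 2 (volume.restrict Ω) → ∫ x in Ω, r x * v.div x = 0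

/-- `K_Ω = |Ω|^{1/2}/2` for `d = 2` and `K_Ω = (2√2/3)|Ω|^{1/6}` for `d = 3`. -/
def K (Ω : Set (E d)) : ℝ :=
  if d = 2 then 1 / 2 * volume.real Ω ^ (1 / 2 : ℝ)
  else 2 * √2 / 3 * volume.real Ω ^ (1 / 6 : ℝ)

/-- `C` is a constant in the Poincaré inequality on `H^1_0(Ω)^d`. -/
def IsPoincareConstant (Ω : Set (E d)) (C : ℝ) : Prop :=
  0 < C ∧ ∀ w : H1 Ω (E d), w.IsZeroBoundary → l2norm Ω w.val ≤ C * w.gradNorm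

/-- The superposition operator `φ ↦ α(φ)` is Lipschitz in the `L^2(Ω)` norm, with constant `γ`, on
`H^1(Ω) ∩ L^∞(Ω)`. -/
def IsL2Lipschitz (Ω : Set (E d)) (α : ℝ → ℝ) (γ : ℝ) : Prop :=
  ∀ φ ψ : H1 Ω ℝ, MemLp φ.val ⊤ (volume.restrict Ω) → MemLp ψ.val ⊤ (volume.restrict Ω) →
    l2norm Ω (fun x => α (ψ.val x) - α (φ.val x)) ≤ γ * l2norm Ω (ψ - φ).val

/-- `γ(1+C_p)²/K_Ω`. -/
def lipState (Ω : Set (E d)) (γ Cp : ℝ) : ℝ := γ * (1 + Cp) ^ 2 / K Ω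

/-- `max {2K_Ω C̃₁C₂, γ(1+C_p)²(C₁+C₂), α₀C_p²C̃₁ + μC̃₁}`, where `C̃₁ = γ(1+C_p)²/K_Ω`. -/
def lipAdjoint (Ω : Set (E d)) (μ α₀ γ Cp C₁ C₂ : ℝ) : ℝ :=
  max (2 * K Ω * lipState Ω γ Cp * C₂)
    (max (γ * (1 + Cp) ^ 2 * (C₁ + C₂)) (α₀ * Cp ^ 2 * lipState Ω γ Cp + μ * lipState Ω γ Cp))

/-- `(2/μ)` times the sum of the three terms in the maximum `lipAdjoint`. -/
def lipAdjointSum (Ω : Set (E d)) (μ α₀ γ Cp C₁ C₂ : ℝ) : ℝ :=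
  2 / μ * (2 * K Ω * lipState Ω γ Cp * C₂ + γ * (1 + Cp) ^ 2 * (C₁ + C₂)
    + (α₀ * Cp ^ 2 * lipState Ω γ Cp + μ * lipState Ω γ Cp))

end Flow

end PhaseFlow

end

open PhaseFlow

open PhaseFlow

/-! ### Cauchy–Schwarz and iterated integrals over coordinate planes -/

section LMarginal
open Finset Function
open scoped ENNReal

variable {δ : Type*} {X : δ → Type*} [∀ i, MeasurableSpace (X i)] [DecidableEq δ]
  (μ : ∀ i, Measure (X i))

/-! The estimates are energy arguments resting on two facts about the convective form b: the bound
|b(u,v,w)| ≤ K_Ω ‖∇u‖‖∇v‖‖∇w‖ (`abs_trilinearForm_le`) and b(u,v,v) = 0 for solenoidal u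
(`trilinearForm_self`).

The first fact comes from a Ladyzhenskaya inequality, ‖u‖₄⁴ ≤ ‖u‖₂^(4-d) ∏ᵢ ‖Dᵢu‖₂, proved for test
functions by integrating along coordinate lines and carried to H^1_0 by Fatou. Hölder on the bounded
set Ω and AM-GM turn it into ‖u‖₄² ≤ K_Ω ‖∇u‖², and also yield a Poincaré constant. No boundary
regularity enters, since test functions extend by zero.

Subtract the two state equations and test with e = u' - u. The pressure drops out, b(u,e,e) = 0, and
b(e,u',e) is absorbed by half of the viscosity because K_Ω‖∇u'‖ ≤ μ/2. What remains is the change of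
the porosity, known only in L², paired with two L⁴ functions; this produces γ(1+C_p)². The adjoint
equations are treated in the same way (`IsAdjointSolution.gradNorm_sub_le`), with extra terms linear
in e.

The energy argument naturally gives 2/μ times a sum of three terms, not their maximum. The maximum
is reached because 𝒞₂ only has to be some bound: it is enlarged, independently of γ and C_p, until
the first entry alone dominates the whole sum. -/

theorem lintegral_mul_le_sqrt_mul_sqrt {α : Type*} [MeasurableSpace α] (ν : Measure α)
    {f g : α → ℝ≥0∞} (hf : AEMeasurable f ν) (hg : AEMeasurable g ν) :
    ∫⁻ a, f a * g a ∂ν ≤ (∫⁻ a, f a ^ 2 ∂ν) ^ (1 / 2 : ℝ) * (∫⁻ a, g a ^ 2 ∂ν) ^ (1 / 2 : ℝ) := by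
  have h := ENNReal.lintegral_mul_le_Lp_mul_Lq ν Real.HolderConjugate.two_two hf hg
  simpa using h

/-- Integrating out the variables in t removes any dependence on those in s ⊆ t, so that factor is a
constant for the outer integral. -/
theorem lmarginal_lmarginal_mul {s t : Finset δ} (hst : s ⊆ t) (f : (∀ i, X i) → ℝ≥0∞)
    {g : (∀ i, X i) → ℝ≥0∞} (hg : Measurable g) :
    ∫⋯∫⁻_s, (∫⋯∫⁻_t, f ∂μ) * g ∂μ = (∫⋯∫⁻_t, f ∂μ) * ∫⋯∫⁻_s, g ∂μ := by
  ext x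
  have h : ∀ y, (∫⋯∫⁻_t, f ∂μ) (updateFinset x s y) = (∫⋯∫⁻_t, f ∂μ) x := fun y =>
    lmarginal_congr μ f fun i hi => by
      simpa [updateFinset] using fun h => absurd (hst h) hi
  simp only [lmarginal, Pi.mul_apply] at h ⊢
  simp only [h]
  rw [lintegral_const_mul]
  exact hg.comp measurable_updateFinset

variable [∀ i, SigmaFinite (μ i)]

/-- One factor no longer depends on the i-th variable and the other no longer on the j-th, so
Tonelli separates the double integral. -/
theorem lmarginal_pair_mul {i j : δ} (hij : i ≠ j) {f g : (∀ i, X i) → ℝ≥0∞}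
    (hf : Measurable f) (hg : Measurable g) :
    ∫⋯∫⁻_{i, j}, (∫⋯∫⁻_{i}, f ∂μ) * (∫⋯∫⁻_{j}, g ∂μ) ∂μ
      = (∫⋯∫⁻_{i, j}, f ∂μ) * (∫⋯∫⁻_{i, j}, g ∂μ) := by
  have hd : Disjoint ({i} : Finset δ) {j} := by simpa using hij
  have hpair : ({i, j} : Finset δ) = {i} ∪ {j} := rfl
  rw [hpair, lmarginal_union μ _ ((hf.lmarginal μ).mul (hg.lmarginal μ)) hd, mul_comm,
    lmarginal_lmarginal_mul μ subset_rfl g (hf.lmarginal μ), ← lmarginal_union' μ f hf hd,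
    mul_comm, lmarginal_lmarginal_mul μ subset_union_left f (hg.lmarginal μ),
    ← lmarginal_union μ g hg hd]

/-- Ladyzhenskaya's inequality on two-dimensional slices, for functions controlled along lines. -/
theorem lmarginal_pair_pow_four_le {i j : δ} (hij : i ≠ j) {f g h : (∀ i, X i) → ℝ≥0∞}
    (hf : Measurable f) (hg : Measurable g) (hh : Measurable h)
    (hi : ∀ x, f x ^ 2 ≤ (∫⋯∫⁻_{i}, f * g ∂μ) x) (hj : ∀ x, f x ^ 2 ≤ (∫⋯∫⁻_{j}, f * h ∂μ) x) :
    ∫⋯∫⁻_{i, j}, f ^ 4 ∂μ ≤ (∫⋯∫⁻_{i, j}, f * g ∂μ) * (∫⋯∫⁻_{i, j}, f * h ∂μ) := by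
  rw [← lmarginal_pair_mul μ hij (hf.mul hg) (hf.mul hh)]
  refine lmarginal_mono fun x => ?_
  simp only [Pi.pow_apply, Pi.mul_apply]
  calc f x ^ 4 = f x ^ 2 * f x ^ 2 := by ring
    _ ≤ _ := mul_le_mul' (hi x) (hj x)

end LMarginal

/-! ### Ladyzhenskaya's inequality from bounds along coordinate lines -/

section Ladyzhenskaya
open Finset Function
open scoped ENNReal

theorem lintegral_pow_four_le_two {X : Fin 2 → Type*} [∀ i, MeasurableSpace (X i)]
    (μ : ∀ i, Measure (X i)) [∀ i, SigmaFinite (μ i)]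
    {f : (∀ i, X i) → ℝ≥0∞} {h : Fin 2 → (∀ i, X i) → ℝ≥0∞}
    (hf : Measurable f) (hh : ∀ i, Measurable (h i))
    (hfh : ∀ i x, f x ^ 2 ≤ (∫⋯∫⁻_{i}, f * h i ∂μ) x) :
    ∫⁻ x, f x ^ 4 ∂Measure.pi μ ≤ ((∫⁻ x, f x ^ 2 ∂Measure.pi μ) ^ (1 / 2 : ℝ)) ^ 2 *
      ∏ i, (∫⁻ x, h i x ^ 2 ∂Measure.pi μ) ^ (1 / 2 : ℝ) := by
  -- Marginals are functions, so a base point is needed to evaluate them, even when all variables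
  -- are integrated out.
  rcases isEmpty_or_nonempty (∀ i, X i) with he | ⟨⟨x⟩⟩
  · simp [lintegral_of_isEmpty]
  have h1 := lmarginal_pair_pow_four_le μ (i := 0) (j := 1) (by decide) hf (hh 0) (hh 1)
    (hfh 0) (hfh 1) x
  have hu : ({0, 1} : Finset (Fin 2)) = univ := by decide
  simp only [hu, lmarginal_univ, Pi.mul_apply, Pi.pow_apply] at h1
  rw [Fin.prod_univ_two]
  refine h1.trans ?_
  refine (mul_le_mul' (lintegral_mul_le_sqrt_mul_sqrt _ hf.aemeasurable (hh 0).aemeasurable)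
    (lintegral_mul_le_sqrt_mul_sqrt _ hf.aemeasurable (hh 1).aemeasurable)).trans (le_of_eq ?_)
  ring

/-- The planar estimate is applied on each slice with the last coordinate fixed. The line bound in
the last direction controls the L² mass of every slice by one number R, and Cauchy–Schwarz in the
last coordinate then recombines the slices. -/
theorem lintegral_pow_four_le_three {X : Fin 3 → Type*} [∀ i, MeasurableSpace (X i)]
    (μ : ∀ i, Measure (X i)) [∀ i, SigmaFinite (μ i)]
    {f : (∀ i, X i) → ℝ≥0∞} {h : Fin 3 → (∀ i, X i) → ℝ≥0∞}
    (hf : Measurable f) (hh : ∀ i, Measurable (h i))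
    (hfh : ∀ i x, f x ^ 2 ≤ (∫⋯∫⁻_{i}, f * h i ∂μ) x) :
    ∫⁻ x, f x ^ 4 ∂Measure.pi μ ≤ (∫⁻ x, f x ^ 2 ∂Measure.pi μ) ^ (1 / 2 : ℝ) *
      ∏ i, (∫⁻ x, h i x ^ 2 ∂Measure.pi μ) ^ (1 / 2 : ℝ) := by
  rcases isEmpty_or_nonempty (∀ i, X i) with he | ⟨⟨x₀⟩⟩
  · simp [lintegral_of_isEmpty]
  have hd : Disjoint ({2} : Finset (Fin 3)) {0, 1} := by decide
  have hu : ({2} ∪ {0, 1} : Finset (Fin 3)) = univ := by decide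
  have hmul : ∀ {g : (∀ i, X i) → ℝ≥0∞}, Measurable g → ∀ x,
      (∫⋯∫⁻_{2}, ∫⋯∫⁻_{0, 1}, g ∂μ ∂μ) x = ∫⁻ x, g x ∂Measure.pi μ := fun hg x => by
    rw [← lmarginal_union μ _ hg hd, hu, lmarginal_univ]
  set R := ∫⁻ x, f x * h 2 x ∂Measure.pi μ with hR
  have hslice : ∀ x, (∫⋯∫⁻_{0, 1}, f ^ 2 ∂μ) x ≤ R := fun x => by
    have h1 : ∫⋯∫⁻_{0, 1}, f ^ 2 ∂μ ≤ ∫⋯∫⁻_{0, 1}, ∫⋯∫⁻_{2}, f * h 2 ∂μ ∂μ :=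
      lmarginal_mono fun x => hfh 2 x
    refine (h1 x).trans (le_of_eq ?_)
    rw [← lmarginal_union' μ _ (hf.mul (hh 2)) hd, hu, lmarginal_univ]
    rfl
  -- Cauchy–Schwarz within a slice, with the mass of f² there replaced by R. Two such factors give
  -- the full power R in `hfour`.
  have hCS : ∀ (g : (∀ i, X i) → ℝ≥0∞), Measurable g → ∀ x, (∫⋯∫⁻_{0, 1}, f * g ∂μ) x ≤
      R ^ (1 / 2 : ℝ) * ((∫⋯∫⁻_{0, 1}, g ^ 2 ∂μ) x) ^ (1 / 2 : ℝ) := fun g hg x => by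
    refine (lintegral_mul_le_sqrt_mul_sqrt _ (hf.comp measurable_updateFinset).aemeasurable
      (hg.comp measurable_updateFinset).aemeasurable).trans ?_
    gcongr
    · exact hslice x
    · exact le_rfl
  have hRR : R ^ (1 / 2 : ℝ) * R ^ (1 / 2 : ℝ) = R := by
    rw [← ENNReal.rpow_add_of_nonneg _ _ (by norm_num) (by norm_num)]; norm_num
  have hsq : ∀ a : ℝ≥0∞, (a ^ (1 / 2 : ℝ)) ^ 2 = a := fun a => by
    rw [← ENNReal.rpow_natCast, ← ENNReal.rpow_mul]; norm_num
  have hfour : ∀ x, (∫⋯∫⁻_{0, 1}, f ^ 4 ∂μ) x ≤ R * (((∫⋯∫⁻_{0, 1}, h 0 ^ 2 ∂μ) x) ^ (1 / 2 : ℝ) *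
      ((∫⋯∫⁻_{0, 1}, h 1 ^ 2 ∂μ) x) ^ (1 / 2 : ℝ)) := fun x => by
    refine (lmarginal_pair_pow_four_le μ (i := 0) (j := 1) (by decide) hf (hh 0) (hh 1)
      (hfh 0) (hfh 1) x).trans ?_
    refine (mul_le_mul' (hCS _ (hh 0) x) (hCS _ (hh 1) x)).trans (le_of_eq ?_)
    conv_rhs => rw [← hRR]
    ring
  have hm : ∀ i, Measurable fun x => ((∫⋯∫⁻_{0, 1}, h i ^ 2 ∂μ) x) ^ (1 / 2 : ℝ) := fun i =>
    (((hh i).pow_const 2).lmarginal μ).pow_const _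
  calc ∫⁻ x, f x ^ 4 ∂Measure.pi μ = (∫⋯∫⁻_{2}, ∫⋯∫⁻_{0, 1}, f ^ 4 ∂μ ∂μ) x₀ :=
        (hmul (hf.pow_const 4) x₀).symm
    _ ≤ (∫⋯∫⁻_{2}, (fun x => R * (((∫⋯∫⁻_{0, 1}, h 0 ^ 2 ∂μ) x) ^ (1 / 2 : ℝ) *
      ((∫⋯∫⁻_{0, 1}, h 1 ^ 2 ∂μ) x) ^ (1 / 2 : ℝ))) ∂μ) x₀ := lmarginal_mono hfour x₀
    _ ≤ R * (((∫⋯∫⁻_{2}, ∫⋯∫⁻_{0, 1}, h 0 ^ 2 ∂μ ∂μ) x₀) ^ (1 / 2 : ℝ) *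
        ((∫⋯∫⁻_{2}, ∫⋯∫⁻_{0, 1}, h 1 ^ 2 ∂μ ∂μ) x₀) ^ (1 / 2 : ℝ)) := by
      simp only [lmarginal.eq_1 μ {2}]
      rw [lintegral_const_mul]
      · gcongr
        refine (lintegral_mul_le_sqrt_mul_sqrt _ ((hm 0).comp measurable_updateFinset).aemeasurable
          ((hm 1).comp measurable_updateFinset).aemeasurable).trans (le_of_eq ?_)
        simp only [comp_apply, hsq]
      · exact ((hm 0).mul (hm 1)).comp measurable_updateFinset
    _ ≤ _ := by
      rw [hmul (g := h 0 ^ 2) ((hh 0).pow_const 2), hmul (g := h 1 ^ 2) ((hh 1).pow_const 2), Fin.prod_univ_three]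
      refine (mul_le_mul_left (lintegral_mul_le_sqrt_mul_sqrt _ hf.aemeasurable
        (hh 2).aemeasurable) _).trans (le_of_eq ?_)
      simp only [Pi.pow_apply]
      ring

end Ladyzhenskaya

/-! ### From test functions to H^1_0 -/

section TestFunctions
open Set
open scoped ENNReal

variable {F : Type} [NormedAddCommGroup F] [InnerProductSpace ℝ F]

/-- The value at b is the integral of the derivative from the left and minus that from the right;
adding both bounds gains the factor 2. -/
theorem HasCompactSupport.two_mul_norm_le_integral_deriv {f : ℝ → ℝ} (hf : ContDiff ℝ 1 f)
    (hc : HasCompactSupport f) (b : ℝ) : 2 * ‖f b‖ ≤ ∫ x, ‖deriv f x‖ := by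
  have hint : Integrable (deriv f) :=
    (hf.continuous_deriv le_rfl).integrable_of_hasCompactSupport hc.deriv
  have h1 : ‖f b‖ ≤ ∫ x in Iic b, ‖deriv f x‖ := by
    rw [← hc.integral_Iic_deriv_eq hf b]
    exact norm_integral_le_integral_norm _
  have h2 : ‖f b‖ ≤ ∫ x in Ioi b, ‖deriv f x‖ := by
    rw [← norm_neg, ← hc.integral_Ioi_deriv_eq hf b]
    exact norm_integral_le_integral_norm _
  have h3 := integral_add_compl (s := Iic b) measurableSet_Iic hint.norm
  rw [compl_Iic] at h3
  linarith

/-- The preceding bound is applied to ‖g‖², whose derivative is 2⟨g, g'⟩; the two factors 2 cancel.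
-/
theorem HasCompactSupport.enorm_sq_le_lintegral {g : ℝ → F} (hg : ContDiff ℝ 1 g)
    (hc : HasCompactSupport g) (b : ℝ) : ‖g b‖ₑ ^ 2 ≤ ∫⁻ x, ‖g x‖ₑ * ‖deriv g x‖ₑ := by
  have hcs : HasCompactSupport fun x => ‖g x‖ ^ 2 := hc.norm.comp_left (g := fun y : ℝ => y ^ 2)
    (by simp)
  have hd : ∀ x, HasDerivAt (fun x => ‖g x‖ ^ 2) (2 * inner ℝ (g x) (deriv g x)) x := fun x =>
    ((hg.differentiable one_ne_zero x).hasDerivAt).norm_sq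
  have h1 := HasCompactSupport.two_mul_norm_le_integral_deriv (hg.norm_sq ℝ) hcs b
  have hint : Integrable fun x => ‖g x‖ * ‖deriv g x‖ :=
    (hg.continuous.norm.mul (hg.continuous_deriv le_rfl).norm).integrable_of_hasCompactSupport
      hc.norm.mul_right
  have h2 : ‖g b‖ ^ 2 ≤ ∫ x, ‖g x‖ * ‖deriv g x‖ := by
    have h3 : ∫ x, ‖deriv (fun x => ‖g x‖ ^ 2) x‖ ≤ ∫ x, 2 * (‖g x‖ * ‖deriv g x‖) := by
      refine integral_mono_of_nonneg (.of_forall fun _ => norm_nonneg _) (hint.const_mul 2)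
        (.of_forall fun x => ?_)
      dsimp only
      rw [(hd x).deriv, norm_mul]
      norm_num
      exact abs_real_inner_le_norm _ _
    rw [integral_const_mul] at h3
    simp only [norm_pow, norm_norm] at h1
    linarith
  calc ‖g b‖ₑ ^ 2 = ENNReal.ofReal (‖g b‖ ^ 2) := by
        rw [ENNReal.ofReal_pow (norm_nonneg _), ofReal_norm]
    _ ≤ ENNReal.ofReal (∫ x, ‖g x‖ * ‖deriv g x‖) := ENNReal.ofReal_le_ofReal h2
    _ = _ := by
      rw [ofReal_integral_eq_lintegral_ofReal hint (.of_forall fun _ => by positivity)]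
      simp only [ENNReal.ofReal_mul (norm_nonneg _), ofReal_norm]

variable {d : ℕ}

theorem enorm_sq_le_lmarginal {ψ : E d → F} (hψ : ContDiff ℝ 1 ψ) (hc : HasCompactSupport ψ)
    (i : Fin d) (x : Fin d → ℝ) :
    ‖ψ (WithLp.toLp 2 x)‖ₑ ^ 2 ≤ (∫⋯∫⁻_{i}, (fun y => ‖ψ (WithLp.toLp 2 y)‖ₑ) *
      (fun y => ‖classicalPartial i ψ (WithLp.toLp 2 y)‖ₑ) ∂fun _ => volume) x := by
  rw [lmarginal_singleton]
  -- The line through x in direction i. It is a closed embedding, so the restriction of ψ to it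
  -- keeps compact support.
  set ℓ : ℝ → E d := fun t => WithLp.toLp 2 (Function.update x i t) with hℓ
  have hℓ' : ∀ t, ℓ t = ℓ 0 + t • EuclideanSpace.single i (1 : ℝ) := fun t => by
    ext j
    by_cases h : j = i
    · subst h; simp [hℓ]
    · simp [hℓ, h]
  have hsmooth : ContDiff ℝ 1 ℓ := by
    rw [funext hℓ']; fun_prop
  have hdℓ : ∀ t, HasDerivAt ℓ (EuclideanSpace.single i (1 : ℝ)) t := fun t => by
    rw [funext hℓ']
    simpa using ((hasDerivAt_id t).smul_const (EuclideanSpace.single i (1 : ℝ))).const_add (ℓ 0)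
  have hcl : Topology.IsClosedEmbedding ℓ :=
    Function.LeftInverse.isClosedEmbedding (f := fun y : E d => y i) (fun t => by simp [hℓ])
      (by fun_prop) hsmooth.continuous
  have h := HasCompactSupport.enorm_sq_le_lintegral (hψ.comp hsmooth)
    (hc.comp_isClosedEmbedding hcl) (x i)
  have hder : ∀ t, deriv (ψ ∘ ℓ) t = classicalPartial i ψ (ℓ t) := fun t =>
    ((hψ.differentiable one_ne_zero (ℓ t)).hasFDerivAt.comp_hasDerivAt t (hdℓ t)).deriv
  simp only [hder] at h
  simpa [hℓ] using h

theorem eLpNorm_natCast_pow {α : Type*} [MeasurableSpace α] (ν : Measure α)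
    {G : Type*} [NormedAddCommGroup G] (f : α → G) {n : ℕ}
    (hn : n ≠ 0) : eLpNorm f n ν ^ n = ∫⁻ x, ‖f x‖ₑ ^ n ∂ν := by
  have h : ((n : ℝ≥0∞)).toReal = n := by simp
  rw [eLpNorm_eq_lintegral_rpow_enorm_toReal (by exact_mod_cast hn) (by simp), h,
    ← ENNReal.rpow_natCast, ← ENNReal.rpow_mul]
  simp [hn]

theorem eLpNorm_two_eq {α : Type*} [MeasurableSpace α] (ν : Measure α)
    {G : Type*} [NormedAddCommGroup G] (f : α → G) :
    eLpNorm f 2 ν = (∫⁻ x, ‖f x‖ₑ ^ 2 ∂ν) ^ (1 / 2 : ℝ) := by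
  rw [eLpNorm_eq_lintegral_rpow_enorm_toReal (by simp) (by simp)]
  simp

/-- **Ladyzhenskaya's inequality** for compactly supported functions in dimension two and three. -/
theorem eLpNorm_four_pow_le_of_hasCompactSupport (hd : d = 2 ∨ d = 3) {ψ : E d → F}
    (hψ : ContDiff ℝ 1 ψ) (hc : HasCompactSupport ψ) :
    eLpNorm ψ 4 volume ^ 4 ≤
      eLpNorm ψ 2 volume ^ (4 - d) * ∏ i, eLpNorm (classicalPartial i ψ) 2 volume := by
  have hcont : ∀ i, Continuous (classicalPartial i ψ) := fun i =>
    (hψ.continuous_fderiv one_ne_zero).clm_apply continuous_const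
  have hmeas : Measurable fun x : Fin d → ℝ => ‖ψ (WithLp.toLp 2 x)‖ₑ :=
    (hψ.continuous.comp (PiLp.continuous_toLp 2 _)).enorm.measurable
  have hmeas' : ∀ i, Measurable fun x : Fin d → ℝ => ‖classicalPartial i ψ (WithLp.toLp 2 x)‖ₑ :=
    fun i => ((hcont i).comp (PiLp.continuous_toLp 2 _)).enorm.measurable
  have htr : ∀ g : E d → ℝ≥0∞, Measurable g →
      ∫⁻ x, g x = ∫⁻ x, g (WithLp.toLp 2 x) ∂Measure.pi fun _ : Fin d => (volume : Measure ℝ) :=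
    fun g hg => ((PiLp.volume_preserving_toLp (Fin d)).lintegral_comp hg).symm
  have h4 := eLpNorm_natCast_pow volume ψ four_ne_zero
  rw [Nat.cast_ofNat] at h4
  simp only [h4, eLpNorm_two_eq]
  rw [htr _ (hψ.continuous.enorm.measurable.pow_const 4), htr _ (hψ.continuous.enorm.measurable.pow_const 2)]
  simp only [htr _ ((hcont _).enorm.measurable.pow_const 2)]
  rcases hd with rfl | rfl
  · exact lintegral_pow_four_le_two _ hmeas hmeas' fun i x => enorm_sq_le_lmarginal hψ hc i x
  · rw [show 4 - 3 = 1 from rfl, pow_one]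
    exact lintegral_pow_four_le_three _ hmeas hmeas' fun i x => enorm_sq_le_lmarginal hψ hc i x

theorem PhaseFlow.IsTestFunction.support_partial_subset {Ω : Set (E d)} {ψ : E d → F}
    (hψ : IsTestFunction Ω ψ) (i : Fin d) : Function.support (classicalPartial i ψ) ⊆ Ω := by
  refine (Function.support_subset_iff'.2 fun x hx => ?_).trans hψ.support
  have : fderiv ℝ ψ x = 0 := by
    by_contra h
    exact hx (support_fderiv_subset ℝ h)
  simp [classicalPartial, this]

theorem PhaseFlow.IsTestFunction.eLpNorm_four_pow_le (hd : d = 2 ∨ d = 3) {Ω : Set (E d)}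
    {ψ : E d → F} (hψ : IsTestFunction Ω ψ) :
    eLpNorm ψ 4 (volume.restrict Ω) ^ 4 ≤ eLpNorm ψ 2 (volume.restrict Ω) ^ (4 - d) *
      ∏ i, eLpNorm (classicalPartial i ψ) 2 (volume.restrict Ω) := by
  have hs : Function.support ψ ⊆ Ω := (subset_tsupport ψ).trans hψ.support
  simp only [eLpNorm_restrict_eq_of_support_subset hs,
    eLpNorm_restrict_eq_of_support_subset (hψ.support_partial_subset _)]
  exact eLpNorm_four_pow_le_of_hasCompactSupport hd (hψ.smooth.of_le (by simp)) hψ.compact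

theorem tendsto_eLpNorm_of_tendsto_eLpNorm_sub {α : Type*} [MeasurableSpace α] {ν : Measure α}
    {G : Type*} [NormedAddCommGroup G] {p : ℝ≥0∞} (hp : 1 ≤ p) {f : ℕ → α → G} {g : α → G}
    (hf : ∀ n, AEStronglyMeasurable (f n) ν) (hg : MemLp g p ν)
    (h : Tendsto (fun n => eLpNorm (fun x => f n x - g x) p ν) atTop (𝓝 0)) :
    Tendsto (fun n => eLpNorm (f n) p ν) atTop (𝓝 (eLpNorm g p ν)) := by
  have h1 : ∀ n, eLpNorm (f n) p ν ≤ eLpNorm g p ν + eLpNorm (fun x => f n x - g x) p ν :=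
    fun n => by
      have := eLpNorm_add_le hg.1 ((hf n).sub hg.1) hp
      rwa [add_sub_cancel] at this
  have h2 : ∀ n, eLpNorm g p ν - eLpNorm (fun x => f n x - g x) p ν ≤ eLpNorm (f n) p ν :=
    fun n => by
      have := eLpNorm_sub_le (hf n) ((hf n).sub hg.1) hp
      rw [sub_sub_cancel] at this
      exact tsub_le_iff_right.2 this
  refine tendsto_of_tendsto_of_tendsto_of_le_of_le ?_ ?_ h2 h1
  · simpa using ENNReal.Tendsto.sub tendsto_const_nhds h (Or.inl hg.2.ne)
  · simpa using tendsto_const_nhds.add h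

namespace PhaseFlow

variable {Ω : Set (E d)}

/-- **Ladyzhenskaya's inequality** in `H^1_0(Ω)`. -/
theorem H1.IsZeroBoundary.eLpNorm_four_pow_le (hd : d = 2 ∨ d = 3) {u : H1 Ω F}
    (hu : u.IsZeroBoundary) :
    eLpNorm u.val 4 (volume.restrict Ω) ^ 4 ≤ eLpNorm u.val 2 (volume.restrict Ω) ^ (4 - d) *
      ∏ i, eLpNorm (u.D i) 2 (volume.restrict Ω) := by
  obtain ⟨ψ, hψ, h0, h1⟩ := hu
  have hm : ∀ n, AEStronglyMeasurable (ψ n) (volume.restrict Ω) := fun n =>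
    ((hψ n).smooth.continuous.memLp_of_hasCompactSupport (p := 2) (hψ n).compact).1.restrict
  have hcont : ∀ n i, Continuous (classicalPartial i (ψ n)) := fun n i =>
    ((hψ n).smooth.continuous_fderiv (by simp)).clm_apply continuous_const
  have hm' : ∀ n i, AEStronglyMeasurable (classicalPartial i (ψ n)) (volume.restrict Ω) :=
    fun n i => ((hcont n i).memLp_of_hasCompactSupport (p := 2)
      ((hψ n).compact.fderiv_apply (𝕜 := ℝ) _)).1.restrict
  -- L² convergence says nothing about L⁴ norms directly. An almost everywhere convergent
  -- subsequence and Fatou bound the left side, while the right side converges.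
  obtain ⟨ns, hns, hae⟩ := (tendstoInMeasure_of_tendsto_eLpNorm two_ne_zero hm u.memLp_val.1
    h0).exists_seq_tendsto_ae
  have hfatou := Lp.eLpNorm_lim_le_liminf_eLpNorm (p := 4) (fun n => hm (ns n)) u.val hae
  have ht0 := (tendsto_eLpNorm_of_tendsto_eLpNorm_sub one_le_two hm u.memLp_val h0).comp
    hns.tendsto_atTop
  have ht1 : ∀ i, Tendsto (fun n => eLpNorm (classicalPartial i (ψ (ns n))) 2 (volume.restrict Ω))
      atTop (𝓝 (eLpNorm (u.D i) 2 (volume.restrict Ω))) := fun i =>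
    (tendsto_eLpNorm_of_tendsto_eLpNorm_sub one_le_two (fun n => hm' n i) (u.memLp_D i)
      (h1 i)).comp hns.tendsto_atTop
  have hne : eLpNorm u.val 2 (volume.restrict Ω) ^ (4 - d) ≠ ⊤ := ENNReal.pow_ne_top
    u.memLp_val.2.ne
  have htp : Tendsto (fun n => ∏ i, eLpNorm (classicalPartial i (ψ (ns n))) 2 (volume.restrict Ω))
      atTop (𝓝 (∏ i, eLpNorm (u.D i) 2 (volume.restrict Ω))) := by
    have hD := fun i => (u.memLp_D i).2.ne
    rcases hd with rfl | rfl
    · simp only [Fin.prod_univ_two]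
      exact ENNReal.Tendsto.mul (ht1 0) (.inr (hD 1)) (ht1 1) (.inr (hD 0))
    · simp only [Fin.prod_univ_three]
      exact ENNReal.Tendsto.mul (ENNReal.Tendsto.mul (ht1 0) (.inr (hD 1)) (ht1 1) (.inr (hD 0)))
        (.inr (hD 2)) (ht1 2) (.inr (ENNReal.mul_ne_top (hD 0) (hD 1)))
  have hlim := ENNReal.Tendsto.mul (((ENNReal.continuous_pow (4 - d)).tendsto _).comp ht0) (.inr (ENNReal.prod_ne_top fun i _ =>
    (u.memLp_D i).2.ne)) htp (.inr hne)
  -- Fatou is stated for the norm itself, so the comparison is made after taking fourth roots.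
  have hroot : Tendsto (fun n => (eLpNorm (ψ (ns n)) 2 (volume.restrict Ω) ^ (4 - d) *
      ∏ i, eLpNorm (classicalPartial i (ψ (ns n))) 2 (volume.restrict Ω)) ^ (1 / 4 : ℝ)) atTop
      (𝓝 ((eLpNorm u.val 2 (volume.restrict Ω) ^ (4 - d) *
        ∏ i, eLpNorm (u.D i) 2 (volume.restrict Ω)) ^ (1 / 4 : ℝ))) :=
    (ENNReal.continuous_rpow_const.tendsto _).comp hlim
  have hle : eLpNorm u.val 4 (volume.restrict Ω) ≤ (eLpNorm u.val 2 (volume.restrict Ω) ^ (4 - d) *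
        ∏ i, eLpNorm (u.D i) 2 (volume.restrict Ω)) ^ (1 / 4 : ℝ) := by
    refine hfatou.trans ?_
    rw [← hroot.liminf_eq]
    refine liminf_le_liminf (.of_forall fun n => ?_)
    have h := ENNReal.rpow_le_rpow ((hψ (ns n)).eLpNorm_four_pow_le hd)
      (show (0 : ℝ) ≤ 1 / 4 by norm_num)
    rw [← ENNReal.rpow_natCast, ← ENNReal.rpow_mul] at h
    norm_num at h ⊢
    exact h
  refine (pow_le_pow_left' hle 4).trans (le_of_eq ?_)
  rw [← ENNReal.rpow_natCast, ← ENNReal.rpow_mul]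
  norm_num

end PhaseFlow

end TestFunctions

/-! ### The constant K_Ω and the Poincaré inequality -/

noncomputable section

namespace PhaseFlow
open scoped ENNReal

variable {d : ℕ} {Ω : Set (E d)} {F : Type} [NormedAddCommGroup F]

/-- The `L^4(Ω)` norm. -/
def l4norm (Ω : Set (E d)) (g : E d → F) : ℝ :=
  (eLpNorm g 4 (volume.restrict Ω)).toReal

lemma l2norm_nonneg (g : E d → F) : 0 ≤ l2norm Ω g := ENNReal.toReal_nonneg

lemma l4norm_nonneg (g : E d → F) : 0 ≤ l4norm Ω g := ENNReal.toReal_nonneg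

section
variable [NormedSpace ℝ F]

lemma H1.gradNorm_nonneg (u : H1 Ω F) : 0 ≤ u.gradNorm := Real.sqrt_nonneg _

lemma H1.gradNorm_sq (u : H1 Ω F) : u.gradNorm ^ 2 = ∑ i, l2norm Ω (u.D i) ^ 2 :=
  Real.sq_sqrt (Finset.sum_nonneg fun _ _ => sq_nonneg _)

end

lemma K_pos (hΩo : IsOpen Ω) (hb : Bornology.IsBounded Ω) (hn : Ω.Nonempty) : 0 < K Ω := by
  have h : 0 < volume.real Ω :=
    ENNReal.toReal_pos (hΩo.measure_pos volume hn).ne' hb.measure_lt_top.ne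
  unfold K
  split_ifs <;> positivity

lemma l2norm_le_l4norm (hb : Bornology.IsBounded Ω) {g : E d → F}
    (hg : MemLp g 4 (volume.restrict Ω)) :
    l2norm Ω g ≤ volume.real Ω ^ (1 / 4 : ℝ) * l4norm Ω g := by
  have h := eLpNorm_le_eLpNorm_mul_rpow_measure_univ (μ := volume.restrict Ω) (p := 2) (q := 4)
    (by norm_num) hg.1
  rw [Measure.restrict_apply_univ] at h
  have h2 := ENNReal.toReal_mono (ENNReal.mul_ne_top hg.2.ne
    (ENNReal.rpow_ne_top_of_nonneg (by norm_num) hb.measure_lt_top.ne)) h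
  rw [ENNReal.toReal_mul, ← ENNReal.toReal_rpow, mul_comm] at h2
  refine h2.trans (le_of_eq ?_)
  norm_num [l4norm, Measure.real]

/-- AM-GM for the squares of three numbers; it supplies the constant when d = 3. -/
lemma mul_mul_sq_le (a b c : ℝ) : 27 * (a * b * c) ^ 2 ≤ (a ^ 2 + b ^ 2 + c ^ 2) ^ 3 := by
  have key : ∀ x y z : ℝ, 0 ≤ x → 0 ≤ y → 0 ≤ z → 27 * (x * y * z) ≤ (x + y + z) ^ 3 := by
    intro x y z hx hy hz
    nlinarith [mul_nonneg hx (sq_nonneg (y - z)), mul_nonneg hy (sq_nonneg (z - x)),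
      mul_nonneg hz (sq_nonneg (x - y)), mul_nonneg hx (sq_nonneg (x - y)),
      mul_nonneg hx (sq_nonneg (x - z)), mul_nonneg hy (sq_nonneg (x - y)),
      mul_nonneg hy (sq_nonneg (y - z)), mul_nonneg hz (sq_nonneg (y - z)),
      mul_nonneg hz (sq_nonneg (x - z))]
  have := key _ _ _ (sq_nonneg a) (sq_nonneg b) (sq_nonneg c)
  nlinarith

variable [InnerProductSpace ℝ F] {u : H1 Ω F}

lemma H1.IsZeroBoundary.memLp_four (hd : d = 2 ∨ d = 3) (hu : u.IsZeroBoundary) :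
    MemLp u.val 4 (volume.restrict Ω) := by
  refine ⟨u.memLp_val.1, lt_top_iff_ne_top.2 fun h => ?_⟩
  have h1 := hu.eLpNorm_four_pow_le hd
  rw [h, ENNReal.top_pow four_ne_zero, top_le_iff] at h1
  exact ENNReal.mul_ne_top (ENNReal.pow_ne_top u.memLp_val.2.ne)
    (ENNReal.prod_ne_top fun i _ => (u.memLp_D i).2.ne) h1

lemma H1.IsZeroBoundary.l4norm_pow_four_le (hd : d = 2 ∨ d = 3) (hu : u.IsZeroBoundary) :
    l4norm Ω u.val ^ 4 ≤ l2norm Ω u.val ^ (4 - d) * ∏ i, l2norm Ω (u.D i) := by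
  have h1 := ENNReal.toReal_mono (ENNReal.mul_ne_top (ENNReal.pow_ne_top u.memLp_val.2.ne)
    (ENNReal.prod_ne_top fun i _ => (u.memLp_D i).2.ne)) (hu.eLpNorm_four_pow_le hd)
  simpa [l4norm, l2norm, ENNReal.toReal_mul, ENNReal.toReal_pow, ENNReal.toReal_prod] using h1

lemma prod_l2norm_le_two {Ω : Set (E 2)} (u : H1 Ω F) :
    2 * ∏ i, l2norm Ω (u.D i) ≤ u.gradNorm ^ 2 := by
  rw [H1.gradNorm_sq, Fin.prod_univ_two, Fin.sum_univ_two, ← mul_assoc]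
  exact two_mul_le_add_sq _ _

lemma prod_l2norm_le_three {Ω : Set (E 3)} (u : H1 Ω F) :
    27 * (∏ i, l2norm Ω (u.D i)) ^ 2 ≤ (u.gradNorm ^ 2) ^ 3 := by
  rw [H1.gradNorm_sq, Fin.prod_univ_three, Fin.sum_univ_three]
  exact mul_mul_sq_le _ _ _

lemma prod_l2norm_nonneg (u : H1 Ω F) : 0 ≤ ∏ i, l2norm Ω (u.D i) :=
  Finset.prod_nonneg fun _ _ => l2norm_nonneg _

lemma prod_l2norm_le (u : H1 Ω F) : ∏ i, l2norm Ω (u.D i) ≤ u.gradNorm ^ d := by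
  refine (Finset.prod_le_prod (fun _ _ => l2norm_nonneg _) (g := fun _ => u.gradNorm)
    fun i _ => ?_).trans (by simp)
  rw [← abs_of_nonneg (l2norm_nonneg (Ω := Ω) (u.D i))]
  refine Real.abs_le_sqrt ?_
  exact Finset.single_le_sum (f := fun i => l2norm Ω (u.D i) ^ 2) (fun _ _ => sq_nonneg _)
    (Finset.mem_univ i)

/-- A second L⁴ bound, through the Poincaré constant instead of K_Ω. It is the source of the factor
(1+C_p)² in the Lipschitz constants. -/
lemma H1.IsZeroBoundary.l4norm_le (hd : d = 2 ∨ d = 3) (hu : u.IsZeroBoundary) {C : ℝ}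
    (hC : 0 < C) (h : l2norm Ω u.val ≤ C * u.gradNorm) :
    l4norm Ω u.val ≤ (1 + C) * u.gradNorm := by
  have hG := u.gradNorm_nonneg
  refine le_of_pow_le_pow_left₀ four_ne_zero (by positivity) ((hu.l4norm_pow_four_le hd).trans ?_)
  have hle : l2norm Ω u.val ≤ (1 + C) * u.gradNorm := h.trans (by nlinarith)
  have hd4 : 4 - d + d = 4 := by omega
  calc l2norm Ω u.val ^ (4 - d) * ∏ i, l2norm Ω (u.D i)
      ≤ ((1 + C) * u.gradNorm) ^ (4 - d) * ((1 + C) * u.gradNorm) ^ d := by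
        refine mul_le_mul (pow_le_pow_left₀ (l2norm_nonneg _) hle _) ((prod_l2norm_le u).trans
          (pow_le_pow_left₀ hG (by nlinarith) _)) (prod_l2norm_nonneg u) (by positivity)
    _ = _ := by rw [← pow_add, hd4]

/-- The embedding of `H^1_0(Ω)` into `L^4(Ω)` with constant `K_Ω^{1/2}`. -/
lemma H1.IsZeroBoundary.l4norm_sq_le (hd : d = 2 ∨ d = 3) (hb : Bornology.IsBounded Ω)
    (hu : u.IsZeroBoundary) : l4norm Ω u.val ^ 2 ≤ K Ω * u.gradNorm ^ 2 := by
  have h4 := hu.l4norm_pow_four_le hd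
  have h2 := l2norm_le_l4norm hb (hu.memLp_four hd)
  have hG := u.gradNorm_nonneg
  have hN := l2norm_nonneg (Ω := Ω) u.val
  have hV : 0 ≤ volume.real Ω := measureReal_nonneg
  have hP := prod_l2norm_nonneg u
  -- Hölder replaces the L² norm by the L⁴ norm x, after which powers of x are cancelled from both
  -- sides; this requires x > 0.
  rcases (l4norm_nonneg (Ω := Ω) u.val).eq_or_lt with h0 | h0
  · rw [← h0]
    have : 0 ≤ K Ω := by unfold K; split_ifs <;> positivity
    simp only [ne_eq, OfNat.ofNat_ne_zero, not_false_eq_true, zero_pow]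
    positivity
  set x := l4norm Ω u.val
  rcases hd with rfl | rfl
  · have hA := prod_l2norm_le_two u
    set P := ∏ i, l2norm Ω (u.D i)
    set V := volume.real Ω ^ (1 / 4 : ℝ) with hVdef
    have hV2 : V ^ 2 = volume.real Ω ^ (1 / 2 : ℝ) := by
      rw [hVdef, ← Real.rpow_natCast, ← Real.rpow_mul hV]; norm_num
    have hK : K Ω = 1 / 2 * V ^ 2 := by simp [K, hV2]
    rw [hK]
    have h5 : x ^ 2 * x ^ 2 ≤ x ^ 2 * (V ^ 2 * P) := by
      calc x ^ 2 * x ^ 2 = x ^ 4 := by ring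
        _ ≤ _ := h4
        _ ≤ (V * x) ^ 2 * P := mul_le_mul_of_nonneg_right (pow_le_pow_left₀ hN h2 2) hP
        _ = _ := by ring
    have h6 := le_of_mul_le_mul_left h5 (by positivity)
    nlinarith [sq_nonneg V]
  · have hA := prod_l2norm_le_three u
    set P := ∏ i, l2norm Ω (u.D i)
    set V := volume.real Ω ^ (1 / 4 : ℝ) with hVdef
    set W := volume.real Ω ^ (1 / 6 : ℝ) with hWdef
    have hW : 0 ≤ W := by positivity
    have hVW : V ^ 2 = W ^ 3 := by
      rw [hVdef, hWdef, ← Real.rpow_natCast, ← Real.rpow_mul hV, ← Real.rpow_natCast,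
        ← Real.rpow_mul hV]
      norm_num
    have hK : K Ω = 2 * √2 / 3 * W := by simp [K, hWdef]
    have h5 : x * x ^ 3 ≤ x * (V * P) := by
      calc x * x ^ 3 = x ^ 4 := by ring
        _ ≤ _ := h4
        _ ≤ (V * x) ^ 1 * P := mul_le_mul_of_nonneg_right (pow_le_pow_left₀ hN h2 1) hP
        _ = _ := by ring
    have h6 := le_of_mul_le_mul_left h5 h0
    have h7 : x ^ 2 ≤ 1 / 3 * (W * u.gradNorm ^ 2) := by
      refine le_of_pow_le_pow_left₀ three_ne_zero (by positivity) ?_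
      calc (x ^ 2) ^ 3 = (x ^ 3) ^ 2 := by ring
        _ ≤ (V * P) ^ 2 := pow_le_pow_left₀ (by positivity) h6 2
        _ = W ^ 3 * P ^ 2 := by rw [mul_pow, hVW]
        _ ≤ W ^ 3 * (1 / 27 * (u.gradNorm ^ 2) ^ 3) := by
          gcongr
          linarith
        _ = _ := by ring
    -- For d = 3 the argument gives the constant |Ω|^(1/6)/3, which is smaller than K_Ω by the
    -- factor 2√2.
    have hs : 1 ≤ √2 := by rw [Real.one_le_sqrt]; norm_num
    have h8 : 0 ≤ W * u.gradNorm ^ 2 := by positivity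
    rw [hK]
    nlinarith

/-- Hölder bounds the L² norm by the L⁴ norm on a set of finite measure, and the L⁴ embedding bounds
that by the gradient; no compactness is needed. -/
lemma exists_isPoincareConstant (hd : d = 2 ∨ d = 3) (hΩo : IsOpen Ω)
    (hb : Bornology.IsBounded Ω) (hn : Ω.Nonempty) : ∃ C, IsPoincareConstant Ω C := by
  have hK := K_pos hΩo hb hn
  have hV : 0 < volume.real Ω :=
    ENNReal.toReal_pos (hΩo.measure_pos volume hn).ne' hb.measure_lt_top.ne
  refine ⟨volume.real Ω ^ (1 / 4 : ℝ) * √(K Ω), by positivity, fun w hw => ?_⟩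
  have h4 : l4norm Ω w.val ≤ √(K Ω) * w.gradNorm := by
    refine le_of_pow_le_pow_left₀ two_ne_zero (mul_nonneg (Real.sqrt_nonneg _) w.gradNorm_nonneg) ?_
    rw [mul_pow, Real.sq_sqrt hK.le]
    exact hw.l4norm_sq_le hd hb
  refine (l2norm_le_l4norm hb (hw.memLp_four hd)).trans ?_
  rw [mul_assoc]
  gcongr

end PhaseFlow

end

/-! ### Hölder estimates, the full gradient and elements of H^1_0 -/

noncomputable section

namespace PhaseFlow
open scoped ENNReal

section Holder

variable {d : ℕ} {Ω : Set (E d)} {F F₁ F₂ F₃ : Type} [NormedAddCommGroup F] [NormedAddCommGroup F₁]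
  [NormedAddCommGroup F₂] [NormedAddCommGroup F₃]

lemma l2norm_norm_mul_norm_le {a : E d → F₁} {b : E d → F₂}
    (ha : MemLp a 4 (volume.restrict Ω)) (hb : MemLp b 4 (volume.restrict Ω)) :
    MemLp (fun x => ‖a x‖ * ‖b x‖) 2 (volume.restrict Ω) ∧
      l2norm Ω (fun x => ‖a x‖ * ‖b x‖) ≤ l4norm Ω a * l4norm Ω b := by
  have hH : ENNReal.HolderTriple 4 4 2 := ⟨by
    rw [← two_mul, show (4 : ℝ≥0∞) = 2 * 2 by norm_num, ENNReal.mul_inv (by simp) (by simp),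
      ← mul_assoc, ENNReal.mul_inv_cancel (by simp) (by simp), one_mul]⟩
  have h := eLpNorm_smul_le_mul_eLpNorm (p := 4) (q := 4) (r := 2) hb.1.norm ha.1.norm
  rw [eLpNorm_norm, eLpNorm_norm] at h
  refine ⟨hb.norm.smul (r := 2) ha.norm, ?_⟩
  have h2 := ENNReal.toReal_mono (ENNReal.mul_ne_top ha.2.ne hb.2.ne) h
  rwa [ENNReal.toReal_mul] at h2

lemma abs_integral_le_l2norm_mul_l2norm {a : E d → F₁} {b : E d → F₂} {f : E d → ℝ}
    (hf : AEStronglyMeasurable f (volume.restrict Ω)) (ha : MemLp a 2 (volume.restrict Ω))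
    (hb : MemLp b 2 (volume.restrict Ω)) (h : ∀ x, |f x| ≤ ‖a x‖ * ‖b x‖) :
    Integrable f (volume.restrict Ω) ∧ |∫ x in Ω, f x| ≤ l2norm Ω a * l2norm Ω b := by
  have hint : Integrable (fun x => ‖a x‖ * ‖b x‖) (volume.restrict Ω) :=
    ha.norm.integrable_mul hb.norm
  refine ⟨hint.mono' hf (.of_forall h), ?_⟩
  have hH := eLpNorm_smul_le_mul_eLpNorm (p := 2) (q := 2) (r := 1) hb.1.norm ha.1.norm
  rw [eLpNorm_norm, eLpNorm_norm] at hH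
  have h2 := ENNReal.toReal_mono (ENNReal.mul_ne_top ha.2.ne hb.2.ne) hH
  rw [ENNReal.toReal_mul, eLpNorm_one_eq_lintegral_enorm,
    ← integral_norm_eq_lintegral_enorm (ha.1.norm.smul hb.1.norm)] at h2
  calc |∫ x in Ω, f x| ≤ ∫ x in Ω, ‖a x‖ * ‖b x‖ :=
        norm_integral_le_of_norm_le (f := f) hint (.of_forall h)
    _ ≤ _ := by simpa [l2norm] using h2

lemma abs_integral_le_l4norm_mul_l2norm_mul_l4norm {a : E d → F₁} {b : E d → F₂} {c : E d → F₃}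
    {f : E d → ℝ} (hf : AEStronglyMeasurable f (volume.restrict Ω))
    (ha : MemLp a 4 (volume.restrict Ω)) (hb : MemLp b 2 (volume.restrict Ω))
    (hc : MemLp c 4 (volume.restrict Ω)) (h : ∀ x, |f x| ≤ ‖a x‖ * ‖b x‖ * ‖c x‖) :
    Integrable f (volume.restrict Ω) ∧
      |∫ x in Ω, f x| ≤ l4norm Ω a * l2norm Ω b * l4norm Ω c := by
  obtain ⟨h1, h2⟩ := l2norm_norm_mul_norm_le ha hc
  obtain ⟨h3, h4⟩ := abs_integral_le_l2norm_mul_l2norm hf h1 hb fun x => (h x).trans (by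
    rw [Real.norm_of_nonneg (by positivity)]; apply le_of_eq; ring)
  refine ⟨h3, h4.trans ?_⟩
  calc _ ≤ l4norm Ω a * l4norm Ω c * l2norm Ω b :=
        mul_le_mul_of_nonneg_right h2 (l2norm_nonneg _)
    _ = _ := by ring

lemma l2norm_sq_eq {a : E d → F} (ha : MemLp a 2 (volume.restrict Ω)) :
    l2norm Ω a ^ 2 = ∫ x in Ω, ‖a x‖ ^ 2 := by
  have h0 : 0 ≤ ∫ x in Ω, ‖a x‖ ^ 2 := integral_nonneg fun _ => by positivity
  rw [l2norm, ha.eLpNorm_eq_integral_rpow_norm two_ne_zero (by simp),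
    ENNReal.toReal_ofReal (by positivity)]
  simp only [ENNReal.toReal_ofNat, Real.rpow_ofNat]
  rw [← Real.rpow_natCast, ← Real.rpow_mul h0]
  norm_num

end Holder

section Gradient

variable {d : ℕ} {Ω : Set (E d)} {F : Type} [NormedAddCommGroup F] [NormedSpace ℝ F]

/-- The full gradient, with its Frobenius norm. -/
def H1.grad (u : H1 Ω F) (x : E d) : PiLp 2 fun _ : Fin d => F := WithLp.toLp 2 fun i => u.D i x

lemma H1.memLp_grad (u : H1 Ω F) : MemLp u.grad 2 (volume.restrict Ω) :=
  MemLp.of_eval_piLp fun i => u.memLp_D i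

lemma H1.l2norm_grad (u : H1 Ω F) : l2norm Ω u.grad = u.gradNorm := by
  refine (pow_left_inj₀ (l2norm_nonneg _) u.gradNorm_nonneg two_ne_zero).1 ?_
  rw [u.gradNorm_sq, l2norm_sq_eq u.memLp_grad]
  simp only [l2norm_sq_eq (u.memLp_D _)]
  rw [← integral_finsetSum _ fun i _ => (u.memLp_D i).integrable_norm_pow two_ne_zero]
  simp [H1.grad, PiLp.norm_sq_eq_of_L2]

lemma IsTestFunction.sub {ψ χ : E d → F} (hψ : IsTestFunction Ω ψ) (hχ : IsTestFunction Ω χ) :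
    IsTestFunction Ω fun x => ψ x - χ x where
  smooth := hψ.smooth.sub hχ.smooth
  compact := hψ.compact.sub hχ.compact
  support := (tsupport_sub ψ χ).trans (Set.union_subset hψ.support hχ.support)

omit [NormedSpace ℝ F] in
lemma tendsto_eLpNorm_sub_sub {α : Type*} [MeasurableSpace α] {ν : Measure α}
    {f g : ℕ → α → F} {a b : α → F}
    (hf : ∀ n, AEStronglyMeasurable (f n) ν) (hg : ∀ n, AEStronglyMeasurable (g n) ν)
    (ha : AEStronglyMeasurable a ν) (hb : AEStronglyMeasurable b ν)
    (h1 : Tendsto (fun n => eLpNorm (fun x => f n x - a x) 2 ν) atTop (𝓝 0))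
    (h2 : Tendsto (fun n => eLpNorm (fun x => g n x - b x) 2 ν) atTop (𝓝 0)) :
    Tendsto (fun n => eLpNorm (fun x => (f n x - g n x) - (a x - b x)) 2 ν) atTop (𝓝 0) := by
  refine tendsto_of_tendsto_of_tendsto_of_le_of_le tendsto_const_nhds (by simpa using h1.add h2)
    (fun _ => zero_le) fun n => ?_
  have := eLpNorm_sub_le ((hf n).sub ha) ((hg n).sub hb) (one_le_two (α := ℝ≥0∞))
  refine (le_of_eq ?_).trans this
  congr 1
  ext x
  simp only [Pi.sub_apply]
  abel

lemma IsTestFunction.memLp {ψ : E d → F} (hψ : IsTestFunction Ω ψ) (p : ℝ≥0∞) :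
    MemLp ψ p (volume.restrict Ω) :=
  (hψ.smooth.continuous.memLp_of_hasCompactSupport hψ.compact).restrict Ω

lemma IsTestFunction.memLp_partial {ψ : E d → F} (hψ : IsTestFunction Ω ψ) (i : Fin d)
    (p : ℝ≥0∞) : MemLp (classicalPartial i ψ) p (volume.restrict Ω) :=
  (((hψ.smooth.continuous_fderiv (by simp)).clm_apply continuous_const).memLp_of_hasCompactSupport
    (hψ.compact.fderiv_apply (𝕜 := ℝ) _)).restrict Ω

lemma H1.IsZeroBoundary.sub {u v : H1 Ω F} (hu : u.IsZeroBoundary) (hv : v.IsZeroBoundary) :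
    (u - v).IsZeroBoundary := by
  obtain ⟨ψ, hψ, h0, h1⟩ := hu
  obtain ⟨χ, hχ, k0, k1⟩ := hv
  refine ⟨fun n x => ψ n x - χ n x, fun n => (hψ n).sub (hχ n), ?_, fun i => ?_⟩
  · exact tendsto_eLpNorm_sub_sub (fun n => ((hψ n).memLp 2).1) (fun n => ((hχ n).memLp 2).1)
      u.memLp_val.1 v.memLp_val.1 h0 k0
  · have h := tendsto_eLpNorm_sub_sub (fun n => ((hψ n).memLp_partial i 2).1)
      (fun n => ((hχ n).memLp_partial i 2).1) (u.memLp_D i).1 (v.memLp_D i).1 (h1 i) (k1 i)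
    have he : ∀ n, classicalPartial i (fun x => ψ n x - χ n x) =
        fun x => classicalPartial i (ψ n) x - classicalPartial i (χ n) x := fun n => by
      ext x
      simp [classicalPartial, fderiv_fun_sub
        ((hψ n).smooth.differentiable (by simp) x) ((hχ n).smooth.differentiable (by simp) x)]
    simp only [he]
    exact h

/-- Smooth functions are weakly differentiable. -/
lemma isWeakPartial_classicalPartial {u : E d → F} (hu : ContDiff ℝ 1 u) (i : Fin d) :
    IsWeakPartial Ω i u (classicalPartial i u) := by
  intro ψ hψ
  obtain ⟨h1, h2⟩ := hψ.partial_cont i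
  have hcu : Continuous (classicalPartial i u) :=
    (hu.continuous_fderiv one_ne_zero).clm_apply continuous_const
  have h := integral_smul_fderiv_eq_neg_fderiv_smul_of_integrable (μ := (volume : Measure (E d)))
    (f := ψ) (g := u) (v := EuclideanSpace.single i 1)
    ((h1.smul hu.continuous).integrable_of_hasCompactSupport h2.smul_right)
    ((hψ.smooth.continuous.smul hcu).integrable_of_hasCompactSupport hψ.compact.smul_right)
    ((hψ.smooth.continuous.smul hu.continuous).integrable_of_hasCompactSupport
      hψ.compact.smul_right)
    (fun x _ => hψ.smooth.differentiable (by simp) x) fun x _ => hu.differentiable one_ne_zero x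
  rw [setIntegral_eq_integral_of_forall_compl_eq_zero fun x hx => ?_,
    setIntegral_eq_integral_of_forall_compl_eq_zero fun x hx => ?_]
  · simp only [classicalPartial] at h ⊢
    rw [h, neg_neg]
  · rw [image_eq_zero_of_notMem_tsupport fun h => hx (hψ.support h), zero_smul]
  · rw [Function.notMem_support.1 fun h => hx (hψ.support_partial_subset i h), zero_smul]

/-- A test function as an element of `H^1(Ω)`. -/
def H1.ofTest (ψ : E d → F) (hψ : IsTestFunction Ω ψ) : H1 Ω F where
  val := ψ
  D i := classicalPartial i ψ
  memLp_val := hψ.memLp 2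
  memLp_D i := hψ.memLp_partial i 2
  isWeakPartial := isWeakPartial_classicalPartial (hψ.smooth.of_le (by simp))

lemma H1.isZeroBoundary_ofTest {ψ : E d → F} (hψ : IsTestFunction Ω ψ) :
    (H1.ofTest ψ hψ).IsZeroBoundary :=
  ⟨fun _ => ψ, fun _ => hψ, by simp [H1.ofTest], fun i => by simp [H1.ofTest]⟩

/-- A constant as an element of `H^1(Ω)`. -/
def H1.const (hb : Bornology.IsBounded Ω) (c : F) : H1 Ω F where
  val _ := c
  D _ _ := 0
  memLp_val := by
    have : IsFiniteMeasure (volume.restrict Ω) := ⟨by simpa using hb.measure_lt_top⟩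
    exact memLp_const c
  memLp_D _ := MemLp.zero
  isWeakPartial i := by
    have h := isWeakPartial_classicalPartial (Ω := Ω) (u := fun _ => c) contDiff_const i
    have h0 : classicalPartial i (fun _ : E d => c) = fun _ => 0 := by
      ext x; simp [classicalPartial]
    rwa [h0] at h

end Gradient

end PhaseFlow

end

/-! ### Viscous, convective and porous forms -/

noncomputable section

namespace PhaseFlow
open scoped ENNReal

variable {d : ℕ} {Ω : Set (E d)}

section Viscous

lemma viscousForm_eq (μ : ℝ) (u v : H1 Ω (E d)) :
    viscousForm μ u v = μ * ∫ x in Ω, inner ℝ (u.grad x) (v.grad x) := by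
  simp [viscousForm, H1.grad, PiLp.inner_apply]

lemma viscous_integrable (u v : H1 Ω (E d)) :
    Integrable (fun x => inner ℝ (u.grad x) (v.grad x)) (volume.restrict Ω) ∧
      |∫ x in Ω, inner ℝ (u.grad x) (v.grad x)| ≤ u.gradNorm * v.gradNorm := by
  have h := abs_integral_le_l2norm_mul_l2norm (u.memLp_grad.1.inner v.memLp_grad.1)
    u.memLp_grad v.memLp_grad fun x => abs_real_inner_le_norm _ _
  rwa [u.l2norm_grad, v.l2norm_grad] at h

lemma viscousForm_sub_left (μ : ℝ) (u u' v : H1 Ω (E d)) :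
    viscousForm μ (u' - u) v = viscousForm μ u' v - viscousForm μ u v := by
  simp only [viscousForm_eq]
  rw [← mul_sub, ← integral_sub (viscous_integrable u' v).1 (viscous_integrable u v).1]
  simp only [← inner_sub_left]
  rfl

lemma viscousForm_self (μ : ℝ) (u : H1 Ω (E d)) : viscousForm μ u u = μ * u.gradNorm ^ 2 := by
  rw [viscousForm_eq, ← u.l2norm_grad, l2norm_sq_eq u.memLp_grad]
  simp

lemma viscousForm_le {μ : ℝ} (hμ : 0 ≤ μ) (u v : H1 Ω (E d)) :
    viscousForm μ u v ≤ μ * (u.gradNorm * v.gradNorm) := by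
  rw [viscousForm_eq]
  exact mul_le_mul_of_nonneg_left ((le_abs_self _).trans (viscous_integrable u v).2) hμ

end Viscous

section Trilinear

/-- Cauchy–Schwarz over j against the Frobenius norm, so that no dimensional factor spoils the
constant K_Ω. -/
lemma norm_sum_smul_le (a : E d) (b : Fin d → E d) :
    ‖∑ j, a j • b j‖ ≤ ‖a‖ * ‖(WithLp.toLp 2 b : PiLp 2 fun _ : Fin d => E d)‖ := by
  refine (norm_sum_le _ _).trans ?_
  simp only [norm_smul]
  rw [EuclideanSpace.norm_eq, PiLp.norm_eq_of_L2]
  exact Real.sum_mul_le_sqrt_mul_sqrt _ _ _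

lemma trilinear_integrable {u v w : H1 Ω (E d)} (hu : MemLp u.val 4 (volume.restrict Ω))
    (hw : MemLp w.val 4 (volume.restrict Ω)) :
    Integrable (fun x => inner ℝ (∑ j, (u.val x) j • v.D j x) (w.val x)) (volume.restrict Ω) ∧
      |trilinearForm u v w| ≤ l4norm Ω u.val * v.gradNorm * l4norm Ω w.val := by
  rw [← v.l2norm_grad]
  refine abs_integral_le_l4norm_mul_l2norm_mul_l4norm ?_ hu v.memLp_grad hw fun x => ?_
  · refine AEStronglyMeasurable.inner ?_ hw.1
    refine Finset.aestronglyMeasurable_fun_sum _ fun j _ => ?_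
    exact AEStronglyMeasurable.smul
      ((EuclideanSpace.proj (𝕜 := ℝ) j).continuous.comp_aestronglyMeasurable hu.1) (v.memLp_D j).1
  · exact (abs_real_inner_le_norm _ _).trans
      (mul_le_mul_of_nonneg_right (norm_sum_smul_le _ _) (norm_nonneg _))

variable {u u' v v' w w' : H1 Ω (E d)}

lemma trilinearForm_sub_left (hu : MemLp u.val 4 (volume.restrict Ω))
    (hu' : MemLp u'.val 4 (volume.restrict Ω)) (hw : MemLp w.val 4 (volume.restrict Ω)) :
    trilinearForm (u' - u) v w = trilinearForm u' v w - trilinearForm u v w := by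
  unfold trilinearForm
  rw [← integral_sub (trilinear_integrable hu' hw).1 (trilinear_integrable hu hw).1]
  simp only [← inner_sub_left, ← Finset.sum_sub_distrib, ← sub_smul]
  rfl

lemma trilinearForm_sub_mid (hu : MemLp u.val 4 (volume.restrict Ω))
    (hw : MemLp w.val 4 (volume.restrict Ω)) :
    trilinearForm u (v' - v) w = trilinearForm u v' w - trilinearForm u v w := by
  unfold trilinearForm
  rw [← integral_sub (trilinear_integrable hu hw).1 (trilinear_integrable hu hw).1]
  simp only [← inner_sub_left, ← Finset.sum_sub_distrib, ← smul_sub]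
  rfl

lemma trilinearForm_sub_right (hu : MemLp u.val 4 (volume.restrict Ω))
    (hw : MemLp w.val 4 (volume.restrict Ω)) (hw' : MemLp w'.val 4 (volume.restrict Ω)) :
    trilinearForm u v (w' - w) = trilinearForm u v w' - trilinearForm u v w := by
  unfold trilinearForm
  rw [← integral_sub (trilinear_integrable hu hw').1 (trilinear_integrable hu hw).1]
  simp only [← inner_sub_right]
  rfl

lemma abs_trilinearForm_le (hd : d = 2 ∨ d = 3) (hb : Bornology.IsBounded Ω)
    (hu : u.IsZeroBoundary) (hw : w.IsZeroBoundary) :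
    |trilinearForm u v w| ≤ K Ω * (u.gradNorm * v.gradNorm * w.gradNorm) := by
  refine (trilinear_integrable (hu.memLp_four hd) (hw.memLp_four hd)).2.trans ?_
  have hK : 0 ≤ K Ω := by unfold K; split_ifs <;> positivity
  have h1 : l4norm Ω u.val * l4norm Ω w.val ≤ K Ω * (u.gradNorm * w.gradNorm) := by
    refine le_of_pow_le_pow_left₀ two_ne_zero (mul_nonneg hK (mul_nonneg u.gradNorm_nonneg
      w.gradNorm_nonneg)) ?_
    calc (l4norm Ω u.val * l4norm Ω w.val) ^ 2 = l4norm Ω u.val ^ 2 * l4norm Ω w.val ^ 2 := by ring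
      _ ≤ (K Ω * u.gradNorm ^ 2) * (K Ω * w.gradNorm ^ 2) :=
        mul_le_mul (hu.l4norm_sq_le hd hb) (hw.l4norm_sq_le hd hb) (sq_nonneg _) (by positivity)
      _ = _ := by ring
  calc _ = l4norm Ω u.val * l4norm Ω w.val * v.gradNorm := by ring
    _ ≤ K Ω * (u.gradNorm * w.gradNorm) * v.gradNorm :=
      mul_le_mul_of_nonneg_right h1 v.gradNorm_nonneg
    _ = _ := by ring

lemma H1.memLp_div (u : H1 Ω (E d)) : MemLp u.div 2 (volume.restrict Ω) :=
  memLp_finsetSum _ fun i _ => (u.memLp_D i).eval_piLp i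

/-- Against a test function the convective term of a solenoidal field is skew-symmetric. -/
lemma trilinearForm_ofTest_self (hdiv : ∀ r : E d → ℝ, MemLp r 2 (volume.restrict Ω) →
      ∫ x in Ω, u.div x * r x = 0) {ψ : E d → E d} (hψ : IsTestFunction Ω ψ) :
    trilinearForm u (H1.ofTest ψ hψ) (H1.ofTest ψ hψ) = 0 := by
  -- Since (u·∇)ψ·ψ = ½ u·∇|ψ|², the function |ψ|² is used twice: as test function for the weak
  -- derivatives of u, and as multiplier in the divergence condition.
  set χ : E d → ℝ := fun x => ‖ψ x‖ ^ 2 with hχdef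
  have hχ : IsTestFunction Ω χ :=
    { smooth := hψ.smooth.norm_sq ℝ
      compact := hψ.compact.norm.comp_left (g := fun y : ℝ => y ^ 2) (by simp)
      support := (closure_mono fun x hx => by
        simp only [hχdef, Function.mem_support] at hx ⊢
        exact fun h => hx (by simp [h])).trans hψ.support }
  have hD : ∀ j x, classicalPartial j χ x = 2 * inner ℝ (classicalPartial j ψ x) (ψ x) :=
    fun j x => by
      have h := ((hψ.smooth.differentiable (by simp) x).hasFDerivAt).norm_sq
      simp only [classicalPartial]
      rw [h.fderiv]
      simp [real_inner_comm]
  have hint1 : ∀ j, Integrable (fun x => classicalPartial j χ x • u.val x) (volume.restrict Ω) :=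
    fun j => IsTestFunction.integrable_smul (hχ.partial_cont j).1 (hχ.partial_cont j).2 u.memLp_val
  have hint2 : ∀ j, Integrable (fun x => χ x • u.D j x) (volume.restrict Ω) :=
    fun j => IsTestFunction.integrable_smul hχ.smooth.continuous hχ.compact (u.memLp_D j)
  have hcomp : ∀ j, ∫ x in Ω, classicalPartial j χ x * u.val x j = -∫ x in Ω, χ x * u.D j x j :=
    fun j => by
      have h := congrArg (fun y : E d => y j) (u.isWeakPartial j χ hχ)
      simp only [PiLp.neg_apply] at h
      rw [eval_integral_piLp fun i => (hint1 j).eval_piLp i,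
        eval_integral_piLp fun i => (hint2 j).eval_piLp i] at h
      simpa using h
  have hsum : ∫ x in Ω, ∑ j, classicalPartial j χ x * u.val x j = 0 := by
    rw [integral_finsetSum _ fun j _ => by simpa using (hint1 j).eval_piLp j]
    simp only [hcomp]
    rw [Finset.sum_neg_distrib, ← integral_finsetSum _ fun j _ => by
      simpa using (hint2 j).eval_piLp j]
    rw [← hdiv χ (hχ.memLp 2), neg_eq_iff_add_eq_zero]
    have h0 := hdiv χ (hχ.memLp 2)
    simp only [H1.div, Finset.sum_mul] at h0 ⊢
    rw [h0, add_zero, ← h0]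
    simp only [mul_comm]
  have heq : ∀ x, ∑ j, classicalPartial j χ x * u.val x j = 2 * inner ℝ
      (∑ j, (u.val x) j • classicalPartial j ψ x) (ψ x) := fun x => by
    simp only [hD, sum_inner, real_inner_smul_left, Finset.mul_sum]
    exact Finset.sum_congr rfl fun j _ => by ring
  simp only [heq] at hsum
  rw [integral_const_mul] at hsum
  simpa [trilinearForm, H1.ofTest] using hsum

lemma trilinearForm_self (hd : d = 2 ∨ d = 3) (hb : Bornology.IsBounded Ω)
    (hu : u.IsZeroBoundary) (hv : v.IsZeroBoundary)
    (hdiv : ∀ r : E d → ℝ, MemLp r 2 (volume.restrict Ω) → ∫ x in Ω, u.div x * r x = 0) :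
    trilinearForm u v v = 0 := by
  obtain ⟨ψ, hψ, h0, h1⟩ := id hv
  set w : ℕ → H1 Ω (E d) := fun n => H1.ofTest (ψ n) (hψ n) with hw
  have hwz : ∀ n, (w n).IsZeroBoundary := fun n => H1.isZeroBoundary_ofTest (hψ n)
  have hG : Tendsto (fun n => (w n - v).gradNorm) atTop (𝓝 0) := by
    have h2 : ∀ i, Tendsto (fun n => l2norm Ω ((w n - v).D i) ^ 2) atTop (𝓝 0) := fun i => by
      rw [show (0 : ℝ) = (0 : ℝ≥0∞).toReal ^ 2 by simp]
      exact ((ENNReal.tendsto_toReal ENNReal.zero_ne_top).comp (h1 i)).pow 2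
    have h3 := (tendsto_finsetSum Finset.univ fun i _ => h2 i).sqrt
    simpa [H1.gradNorm] using h3
  -- With z = w n - v, expanding b(u, w n, w n) = 0 writes b(u,v,v) through terms that each contain
  -- z, and these vanish as ∇z tends to 0.
  have hbound : ∀ n, |trilinearForm u v v| ≤ K Ω * (u.gradNorm * (w n - v).gradNorm *
      (w n - v).gradNorm) + K Ω * (u.gradNorm * (w n - v).gradNorm * v.gradNorm) +
      K Ω * (u.gradNorm * v.gradNorm * (w n - v).gradNorm) := fun n => by
    have hu4 := hu.memLp_four hd
    have hv4 := hv.memLp_four hd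
    have hw4 := (hwz n).memLp_four hd
    have hz := (hwz n).sub hv
    have e0 : trilinearForm u (w n) (w n) = 0 := trilinearForm_ofTest_self hdiv (hψ n)
    have e1 : trilinearForm u (w n - v) (w n - v) = trilinearForm u (w n) (w n) -
        trilinearForm u v (w n) - (trilinearForm u (w n) v - trilinearForm u v v) := by
      rw [trilinearForm_sub_right hu4 hv4 hw4, trilinearForm_sub_mid hu4 hw4,
        trilinearForm_sub_mid hu4 hv4]
    have e2 := trilinearForm_sub_mid (v := v) (v' := w n) hu4 hv4
    have e3 := trilinearForm_sub_right (v := v) hu4 hv4 hw4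
    have b1 := abs_trilinearForm_le (v := w n - v) hd hb hu hz
    have b2 := abs_trilinearForm_le (v := w n - v) hd hb hu hv
    have b3 := abs_trilinearForm_le (v := v) hd hb hu hz
    have e : trilinearForm u v v = -(trilinearForm u (w n - v) (w n - v)) -
        trilinearForm u (w n - v) v - trilinearForm u v (w n - v) := by
      rw [e1, e2, e3, e0]; ring
    rw [e]
    refine (abs_sub _ _).trans (add_le_add ((abs_sub _ _).trans (add_le_add ?_ b2)) b3)
    rwa [abs_neg]
  have hlim : Tendsto (fun n => K Ω * (u.gradNorm * (w n - v).gradNorm *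
      (w n - v).gradNorm) + K Ω * (u.gradNorm * (w n - v).gradNorm * v.gradNorm) +
      K Ω * (u.gradNorm * v.gradNorm * (w n - v).gradNorm)) atTop (𝓝 0) := by
    have t1 := (((hG.const_mul u.gradNorm).mul hG).const_mul (K Ω))
    have t2 := (((hG.const_mul u.gradNorm).mul_const v.gradNorm).const_mul (K Ω))
    have t3 := ((hG.const_mul (u.gradNorm * v.gradNorm)).const_mul (K Ω))
    simpa using (t1.add t2).add t3
  exact abs_nonpos_iff.1 (ge_of_tendsto' hlim hbound)

end Trilinear

section Porous

/-- `∫_Ω c u · v` for a weight `c`. -/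
def weightedForm (c : E d → ℝ) (u v : H1 Ω (E d)) : ℝ :=
  ∫ x in Ω, c x * inner ℝ (u.val x) (v.val x)

variable {c : E d → ℝ} {u v : H1 Ω (E d)}

lemma weighted_aestronglyMeasurable (hc : AEStronglyMeasurable c (volume.restrict Ω))
    (u v : H1 Ω (E d)) :
    AEStronglyMeasurable (fun x => c x * inner ℝ (u.val x) (v.val x)) (volume.restrict Ω) :=
  hc.mul (u.memLp_val.1.inner v.memLp_val.1)

lemma weighted_integrable {α₀ : ℝ} (hc : AEStronglyMeasurable c (volume.restrict Ω))
    (hc0 : ∀ x, |c x| ≤ α₀) (u v : H1 Ω (E d)) :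
    Integrable (fun x => c x * inner ℝ (u.val x) (v.val x)) (volume.restrict Ω) ∧
      |weightedForm c u v| ≤ α₀ * (l2norm Ω u.val * l2norm Ω v.val) := by
  have h := abs_integral_le_l2norm_mul_l2norm (f := fun x => c x * inner ℝ (u.val x) (v.val x))
    (a := fun x => α₀ • u.val x) (weighted_aestronglyMeasurable hc u v)
    (u.memLp_val.const_smul α₀) v.memLp_val fun x => by
      have hα : |c x| ≤ |α₀| := (hc0 x).trans (le_abs_self _)
      rw [abs_mul, norm_smul, Real.norm_eq_abs, mul_assoc]
      exact mul_le_mul hα (abs_real_inner_le_norm _ _) (abs_nonneg _) (abs_nonneg _)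
  refine ⟨h.1, h.2.trans (le_of_eq ?_)⟩
  have hle : 0 ≤ α₀ := (abs_nonneg _).trans (hc0 0)
  have : l2norm Ω (fun x => α₀ • u.val x) = α₀ * l2norm Ω u.val := by
    have := eLpNorm_const_smul α₀ u.val 2 (volume.restrict Ω)
    simp only [l2norm]
    rw [show (fun x => α₀ • u.val x) = α₀ • u.val from rfl, this]
    simp [hle]
  rw [this, mul_assoc]

/-- Used for a difference of two porosities, which is small only in L²; both velocities must
therefore be placed in L⁴. -/
lemma abs_weightedForm_le_of_memLp_two (hc : MemLp c 2 (volume.restrict Ω))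
    (hu : MemLp u.val 4 (volume.restrict Ω)) (hv : MemLp v.val 4 (volume.restrict Ω)) :
    |weightedForm c u v| ≤ l2norm Ω c * (l4norm Ω u.val * l4norm Ω v.val) := by
  have h := abs_integral_le_l4norm_mul_l2norm_mul_l4norm
    (weighted_aestronglyMeasurable hc.1 u v) hu hc hv fun x => by
      rw [abs_mul, mul_comm ‖u.val x‖, mul_assoc]
      exact mul_le_mul_of_nonneg_left (abs_real_inner_le_norm _ _) (abs_nonneg _)
  refine h.2.trans (le_of_eq ?_)
  ring

lemma weightedForm_nonneg (hc : ∀ x, 0 ≤ c x) (u : H1 Ω (E d)) : 0 ≤ weightedForm c u u :=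
  integral_nonneg fun x => mul_nonneg (hc x) real_inner_self_nonneg

/-- Change of a weighted form when both the weight and the first argument change. -/
lemma weightedForm_sub_weightedForm {c c' : E d → ℝ} {α₀ : ℝ} {u u' v : H1 Ω (E d)}
    (hc : AEStronglyMeasurable c (volume.restrict Ω)) (hc0 : ∀ x, |c x| ≤ α₀)
    (hc' : AEStronglyMeasurable c' (volume.restrict Ω)) (hc0' : ∀ x, |c' x| ≤ α₀) :
    weightedForm c' u' v - weightedForm c u v =
      weightedForm c (u' - u) v + weightedForm (fun x => c' x - c x) u' v := by
  have i1 := (weighted_integrable hc hc0 u v).1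
  have i2 := (weighted_integrable hc hc0 u' v).1
  have i3 := (weighted_integrable hc' hc0' u' v).1
  have e1 : weightedForm c (u' - u) v = weightedForm c u' v - weightedForm c u v := by
    simp only [weightedForm]
    rw [← integral_sub i2 i1]
    simp only [← mul_sub, ← inner_sub_left]
    rfl
  have e2 : weightedForm (fun x => c' x - c x) u' v =
      weightedForm c' u' v - weightedForm c u' v := by
    simp only [weightedForm]
    rw [← integral_sub i3 i2]
    simp only [sub_mul]
  rw [e1, e2]
  ring

end Porous

end PhaseFlow

end

/-! ### Energy estimates for states, adjoints and their differences -/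

noncomputable section

namespace PhaseFlow
open scoped ENNReal

variable {d : ℕ} {Ω : Set (E d)}

section Solenoidal

/-- `∇·u = 0` in `Ω`, tested against `L^2(Ω)`. -/
def H1.IsSolenoidal (u : H1 Ω (E d)) : Prop :=
  ∀ r : E d → ℝ, MemLp r 2 (volume.restrict Ω) → ∫ x in Ω, u.div x * r x = 0

lemma H1.IsSolenoidal.sub {u u' : H1 Ω (E d)} (hu' : u'.IsSolenoidal) (hu : u.IsSolenoidal) :
    (u' - u).IsSolenoidal := by
  intro r hr
  have h : ∀ x, (u' - u).div x = u'.div x - u.div x := fun x =>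
    Finset.sum_sub_distrib (f := fun i => u'.D i x i) (g := fun i => u.D i x i)
  simp only [h, sub_mul]
  refine (integral_sub (u'.memLp_div.integrable_mul hr) (u.memLp_div.integrable_mul hr)).trans ?_
  simp only [Pi.mul_apply]
  rw [hu' r hr, hu r hr, sub_zero]

lemma H1.IsSolenoidal.integral_mul_div {u : H1 Ω (E d)} (hu : u.IsSolenoidal) {p : E d → ℝ}
    (hp : MemLp p 2 (volume.restrict Ω)) : ∫ x in Ω, p x * u.div x = 0 := by
  simpa only [mul_comm] using hu p hp

variable {μ : ℝ} {f : E d → E d} {α : ℝ → ℝ} {φ : H1 Ω ℝ} {u v : H1 Ω (E d)} {p q : E d → ℝ}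

lemma IsStateSolution.isSolenoidal (h : IsStateSolution μ f α φ u p) : u.IsSolenoidal :=
  h.continuity

lemma IsAdjointSolution.isSolenoidal (h : IsAdjointSolution μ α φ u v q) : v.IsSolenoidal :=
  fun r hr => by simpa only [mul_comm] using h.continuity r hr

end Solenoidal

/-- Constants belong to H^1 ∩ L^∞ on a bounded set, and testing the L² condition on them cancels the
common factor |Ω|^(1/2). -/
lemma abs_sub_le_of_isL2Lipschitz (hΩo : IsOpen Ω) (hb : Bornology.IsBounded Ω)
    (hn : Ω.Nonempty) {α : ℝ → ℝ} {γ : ℝ} (h : IsL2Lipschitz Ω α γ) (s t : ℝ) :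
    |α t - α s| ≤ γ * |t - s| := by
  have : IsFiniteMeasure (volume.restrict Ω) := ⟨by simpa using hb.measure_lt_top⟩
  have hpos : 0 < volume Ω := hΩo.measure_pos volume hn
  have h1 := h (H1.const hb s) (H1.const hb t) (memLp_const s) (memLp_const t)
  have hne : volume.restrict Ω ≠ 0 := by
    rw [ne_eq, Measure.restrict_eq_zero]
    exact hpos.ne'
  have hl : ∀ c : ℝ, l2norm Ω (fun _ => c) = |c| * (volume Ω ^ (1 / 2 : ℝ)).toReal := fun c => by
    rw [l2norm, eLpNorm_const _ two_ne_zero hne]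
    simp
  have h2 : l2norm Ω (fun _ => α t - α s) ≤ γ * l2norm Ω (fun _ : E d => t - s) := h1
  rw [hl, hl, ← mul_assoc] at h2
  refine le_of_mul_le_mul_right h2 (ENNReal.toReal_pos ?_ ?_)
  · simp [hpos.ne', hb.measure_lt_top.ne]
  · exact ENNReal.rpow_ne_top_of_nonneg (by norm_num) hb.measure_lt_top.ne

/-- No measurability of α is assumed; it follows from pointwise Lipschitz continuity, and without it
the porous integrals could not be split or bounded. -/
lemma aestronglyMeasurable_comp_of_isL2Lipschitz (hΩo : IsOpen Ω) (hb : Bornology.IsBounded Ω)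
    (hn : Ω.Nonempty) {α : ℝ → ℝ} {γ : ℝ} (hγ : 0 ≤ γ) (h : IsL2Lipschitz Ω α γ) (φ : H1 Ω ℝ) :
    AEStronglyMeasurable (fun x => α (φ.val x)) (volume.restrict Ω) := by
  have hL : LipschitzWith ⟨γ, hγ⟩ α := LipschitzWith.of_dist_le_mul fun x y => by
    rw [Real.dist_eq, Real.dist_eq]
    exact abs_sub_le_of_isL2Lipschitz hΩo hb hn h y x
  exact hL.continuous.comp_aestronglyMeasurable φ.memLp_val.1

lemma H1.norm_le {C : ℝ} (hC : IsPoincareConstant Ω C) {u : H1 Ω (E d)} (hu : u.IsZeroBoundary) :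
    u.norm ≤ (C + 1) * u.gradNorm := by
  have h := hC.2 u hu
  have hG := u.gradNorm_nonneg
  have hl := l2norm_nonneg (Ω := Ω) u.val
  have hC0 := hC.1
  refine Real.sqrt_le_iff.2 ⟨by positivity, ?_⟩
  have h1 := pow_le_pow_left₀ hl h 2
  nlinarith [mul_nonneg hC0.le (sq_nonneg u.gradNorm)]

/-- Closes every energy estimate: half of the viscosity absorbs the convective term, and one power
of the gradient norm is cancelled. -/
lemma half_mul_le_of_sq_le {μ G X : ℝ} (hG : 0 ≤ G) (hX : 0 ≤ X)
    (h : μ * G ^ 2 ≤ μ / 2 * G ^ 2 + X * G) : μ / 2 * G ≤ X := by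
  rcases hG.eq_or_lt with h0 | h0
  · simpa [← h0] using hX
  · refine le_of_mul_le_mul_right (a := G) ?_ h0
    linarith

section Estimates

variable {μ α₀ P Cp : ℝ} {f : E d → E d} {α : ℝ → ℝ} {φ φ' : H1 Ω ℝ} {u u' v v' : H1 Ω (E d)}
  {p p' q q' : E d → ℝ}

lemma abs_weightedForm_le_of_isPoincareConstant (hd : d = 2 ∨ d = 3)
    (hP : IsPoincareConstant Ω P) {c : E d → ℝ} (hc : MemLp c 2 (volume.restrict Ω))
    (hu : u.IsZeroBoundary) (hv : v.IsZeroBoundary) :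
    |weightedForm c u v| ≤ l2norm Ω c * (1 + P) ^ 2 * (u.gradNorm * v.gradNorm) := by
  refine (abs_weightedForm_le_of_memLp_two hc (hu.memLp_four hd) (hv.memLp_four hd)).trans ?_
  have hP0 := hP.1
  have h1 := hu.l4norm_le hd hP0 (hP.2 u hu)
  have h2 := hv.l4norm_le hd hP0 (hP.2 v hv)
  have := u.gradNorm_nonneg
  calc _ ≤ l2norm Ω c * (((1 + P) * u.gradNorm) * ((1 + P) * v.gradNorm)) :=
        mul_le_mul_of_nonneg_left (mul_le_mul h1 h2 (l4norm_nonneg _) (by positivity))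
          (l2norm_nonneg _)
    _ = _ := by ring

lemma abs_porousForm_le (hP : IsPoincareConstant Ω P) (hα : ∀ s, 0 ≤ α s ∧ α s ≤ α₀)
    (hm : AEStronglyMeasurable (fun x => α (φ.val x)) (volume.restrict Ω))
    (hu : u.IsZeroBoundary) (hv : v.IsZeroBoundary) :
    |porousForm α φ u v| ≤ α₀ * P ^ 2 * (u.gradNorm * v.gradNorm) := by
  have hα₀ : 0 ≤ α₀ := (hα 0).1.trans (hα 0).2
  have h := (weighted_integrable hm (fun x => by
    rw [abs_of_nonneg (hα _).1]; exact (hα _).2) u v).2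
  refine h.trans ?_
  have hP0 := hP.1
  have := u.gradNorm_nonneg
  calc _ ≤ α₀ * ((P * u.gradNorm) * (P * v.gradNorm)) :=
        mul_le_mul_of_nonneg_left (mul_le_mul (hP.2 u hu) (hP.2 v hv) (l2norm_nonneg _)
          (by positivity)) hα₀
    _ = _ := by ring

lemma porousForm_sub_porousForm (hα : ∀ s, 0 ≤ α s ∧ α s ≤ α₀)
    (hm : AEStronglyMeasurable (fun x => α (φ.val x)) (volume.restrict Ω))
    (hm' : AEStronglyMeasurable (fun x => α (φ'.val x)) (volume.restrict Ω)) :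
    porousForm α φ' u' v - porousForm α φ u v = porousForm α φ (u' - u) v +
      weightedForm (fun x => α (φ'.val x) - α (φ.val x)) u' v := by
  have hα' : ∀ s, |α s| ≤ α₀ := fun s => by rw [abs_of_nonneg (hα s).1]; exact (hα s).2
  exact weightedForm_sub_weightedForm hm (fun x => hα' _) hm' fun x => hα' _

lemma memLp_comp_sub_comp (hb : Bornology.IsBounded Ω) (hα : ∀ s, 0 ≤ α s ∧ α s ≤ α₀)
    (hm : AEStronglyMeasurable (fun x => α (φ.val x)) (volume.restrict Ω))
    (hm' : AEStronglyMeasurable (fun x => α (φ'.val x)) (volume.restrict Ω)) :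
    MemLp (fun x => α (φ'.val x) - α (φ.val x)) 2 (volume.restrict Ω) := by
  have : IsFiniteMeasure (volume.restrict Ω) := ⟨by simpa using hb.measure_lt_top⟩
  refine MemLp.of_bound (hm'.sub hm) α₀ (.of_forall fun x => ?_)
  rw [Real.norm_eq_abs, abs_sub_le_iff]
  have h1 := hα (φ.val x)
  have h2 := hα (φ'.val x)
  constructor <;> linarith

/-- Energy estimate for the difference of two states. -/
lemma IsStateSolution.gradNorm_sub_le (hd : d = 2 ∨ d = 3) (hb : Bornology.IsBounded Ω)
    (hP : IsPoincareConstant Ω Cp) (hα : ∀ s, 0 ≤ α s ∧ α s ≤ α₀)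
    (hm : AEStronglyMeasurable (fun x => α (φ.val x)) (volume.restrict Ω))
    (hm' : AEStronglyMeasurable (fun x => α (φ'.val x)) (volume.restrict Ω))
    (hu : IsStateSolution μ f α φ u p) (hu' : IsStateSolution μ f α φ' u' p')
    (hsmall : K Ω * u'.gradNorm ≤ μ / 2) :
    μ / 2 * (u' - u).gradNorm ≤
      l2norm Ω (fun x => α (φ'.val x) - α (φ.val x)) * (1 + Cp) ^ 2 * u'.gradNorm := by
  have he := hu'.boundary.sub hu.boundary
  have hsol := hu'.isSolenoidal.sub hu.isSolenoidal
  have hG := (u' - u).gradNorm_nonneg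
  have hG' := u'.gradNorm_nonneg
  have hu4 := hu.boundary.memLp_four hd
  have hu4' := hu'.boundary.memLp_four hd
  have he4 := he.memLp_four hd
  have m := hu.momentum (u' - u) he
  have m' := hu'.momentum (u' - u) he
  rw [hsol.integral_mul_div hu.pressure] at m
  rw [hsol.integral_mul_div hu'.pressure] at m'
  have ea := viscousForm_sub_left μ u u' (u' - u)
  rw [viscousForm_self] at ea
  -- With e = u' - u: b(u',u',e) - b(u,u,e) = b(e,u',e) + b(u,e,e), where the last term vanishes and
  -- the first is absorbed through `hsmall`.
  have eb1 := trilinearForm_sub_left (v := u') hu4 hu4' he4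
  have eb2 := trilinearForm_sub_mid (v := u) (v' := u') hu4 he4
  have eb3 := trilinearForm_self hd hb hu.boundary he hu.continuity
  have ec := porousForm_sub_porousForm (u := u) (u' := u') (v := u' - u) hα hm hm'
  have bb := (abs_le.1 (abs_trilinearForm_le (v := u') hd hb he he)).1
  have bw := (abs_le.1 (abs_weightedForm_le_of_isPoincareConstant hd hP
    (memLp_comp_sub_comp hb hα hm hm') hu'.boundary he)).1
  have bp : 0 ≤ porousForm α φ (u' - u) (u' - u) :=
    weightedForm_nonneg (fun x => (hα (φ.val x)).1) _
  refine half_mul_le_of_sq_le hG (mul_nonneg (mul_nonneg (l2norm_nonneg _) (sq_nonneg _)) hG') ?_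
  have hs := mul_le_mul_of_nonneg_right hsmall (sq_nonneg (u' - u).gradNorm)
  linarith

/-- Energy estimate for the adjoint. -/
lemma IsAdjointSolution.gradNorm_le (hd : d = 2 ∨ d = 3) (hb : Bornology.IsBounded Ω)
    (hP : IsPoincareConstant Ω P) (hμ : 0 < μ) (hα : ∀ s, 0 ≤ α s ∧ α s ≤ α₀)
    (hm : AEStronglyMeasurable (fun x => α (φ.val x)) (volume.restrict Ω))
    (hu : u.IsZeroBoundary) (hsol : u.IsSolenoidal) (hv : IsAdjointSolution μ α φ u v q)
    (hsmall : K Ω * u.gradNorm ≤ μ / 2) :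
    μ / 2 * v.gradNorm ≤ (μ + α₀ * P ^ 2) * u.gradNorm := by
  have hG := v.gradNorm_nonneg
  have hGu := u.gradNorm_nonneg
  have hα₀ : 0 ≤ α₀ := (hα 0).1.trans (hα 0).2
  have m := hv.momentum v hv.boundary
  rw [hv.isSolenoidal.integral_mul_div hv.pressure, viscousForm_self,
    trilinearForm_self hd hb hu hv.boundary hsol] at m
  have bb := (abs_le.1 (abs_trilinearForm_le (v := u) hd hb hv.boundary hv.boundary)).1
  have ba := viscousForm_le hμ.le u v
  have bc := (abs_le.1 (abs_porousForm_le hP hα hm hu hv.boundary)).2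
  have bp : 0 ≤ porousForm α φ v v := weightedForm_nonneg (fun x => (hα (φ.val x)).1) _
  refine half_mul_le_of_sq_le hG (by positivity) ?_
  have hs := mul_le_mul_of_nonneg_right hsmall (sq_nonneg v.gradNorm)
  linarith

/-- Energy estimate for the difference of two adjoints. -/
lemma IsAdjointSolution.gradNorm_sub_le (hd : d = 2 ∨ d = 3) (hb : Bornology.IsBounded Ω)
    (hP : IsPoincareConstant Ω P) (hCp : IsPoincareConstant Ω Cp) (hμ : 0 < μ)
    (hα : ∀ s, 0 ≤ α s ∧ α s ≤ α₀)
    (hm : AEStronglyMeasurable (fun x => α (φ.val x)) (volume.restrict Ω))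
    (hm' : AEStronglyMeasurable (fun x => α (φ'.val x)) (volume.restrict Ω))
    (hu : u.IsZeroBoundary) (hsol : u.IsSolenoidal) (hu' : u'.IsZeroBoundary)
    (hv : IsAdjointSolution μ α φ u v q) (hv' : IsAdjointSolution μ α φ' u' v' q')
    (hsmall : K Ω * u.gradNorm ≤ μ / 2) :
    μ / 2 * (v' - v).gradNorm ≤ 2 * K Ω * (u' - u).gradNorm * v'.gradNorm +
      l2norm Ω (fun x => α (φ'.val x) - α (φ.val x)) * (1 + Cp) ^ 2 *
        (u'.gradNorm + v'.gradNorm) + (α₀ * P ^ 2 + μ) * (u' - u).gradNorm := by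
  set δ := l2norm Ω (fun x => α (φ'.val x) - α (φ.val x)) with hδ
  have hδ0 : 0 ≤ δ := l2norm_nonneg _
  have he := hu'.sub hu
  have hz := hv'.boundary.sub hv.boundary
  have hsolz := hv'.isSolenoidal.sub hv.isSolenoidal
  have hGz := (v' - v).gradNorm_nonneg
  have hGe := (u' - u).gradNorm_nonneg
  have hGu' := u'.gradNorm_nonneg
  have hGv' := v'.gradNorm_nonneg
  have hα₀ : 0 ≤ α₀ := (hα 0).1.trans (hα 0).2
  have hK : 0 ≤ K Ω := by unfold K; split_ifs <;> positivity
  have hu4 := hu.memLp_four hd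
  have hu4' := hu'.memLp_four hd
  have hv4 := hv.boundary.memLp_four hd
  have hv4' := hv'.boundary.memLp_four hd
  have hz4 := hz.memLp_four hd
  have m := hv.momentum (v' - v) hz
  have m' := hv'.momentum (v' - v) hz
  rw [hsolz.integral_mul_div hv.pressure] at m
  rw [hsolz.integral_mul_div hv'.pressure] at m'
  have ea := viscousForm_sub_left μ v v' (v' - v)
  rw [viscousForm_self] at ea
  have ea' := viscousForm_sub_left μ u u' (v' - v)
  have eb1 := trilinearForm_sub_mid (v := u) (v' := u') hz4 hv4'
  have eb2 := trilinearForm_sub_right (v := u) hz4 hv4 hv4'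
  have eb3 := trilinearForm_sub_left (v := v' - v) hu4 hu4' hv4'
  have eb4 := trilinearForm_sub_right (v := v' - v) hu4 hv4 hv4'
  have eb5 := trilinearForm_self hd hb hu hz hsol
  have ec := porousForm_sub_porousForm (u := v) (u' := v') (v := v' - v) hα hm hm'
  have ec' := porousForm_sub_porousForm (u := u) (u' := u') (v := v' - v) hα hm hm'
  have hδm := memLp_comp_sub_comp (φ := φ) (φ' := φ') hb hα hm hm'
  have b1 := (abs_le.1 (abs_trilinearForm_le (v := u' - u) hd hb hz hv'.boundary)).1
  have b2 := (abs_le.1 (abs_trilinearForm_le (v := u) hd hb hz hz)).1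
  have b3 := (abs_le.1 (abs_trilinearForm_le (v := v' - v) hd hb he hv'.boundary)).1
  have b4 := (abs_le.1 (abs_weightedForm_le_of_isPoincareConstant hd hCp hδm hv'.boundary hz)).1
  have b5 := (abs_le.1 (abs_weightedForm_le_of_isPoincareConstant hd hCp hδm hu' hz)).2
  have b6 := (abs_le.1 (abs_porousForm_le hP hα hm he hz)).2
  have b7 := viscousForm_le hμ.le (u' - u) (v' - v)
  have bp : 0 ≤ porousForm α φ (v' - v) (v' - v) :=
    weightedForm_nonneg (fun x => (hα (φ.val x)).1) _
  rw [← hδ] at b4 b5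
  refine half_mul_le_of_sq_le hGz (add_nonneg (add_nonneg
    (mul_nonneg (mul_nonneg (mul_nonneg zero_le_two hK) hGe) hGv')
    (mul_nonneg (mul_nonneg hδ0 (sq_nonneg _)) (add_nonneg hGu' hGv')))
    (mul_nonneg (add_nonneg (mul_nonneg hα₀ (sq_nonneg _)) hμ.le) hGe)) ?_
  have hs := mul_le_mul_of_nonneg_right hsmall (sq_nonneg (v' - v).gradNorm)
  -- The equation for z = v' - v, tested with z, where e = u' - u. The terms b(z,e,v') and b(e,z,v')
  -- produce the factor 2K_Ω, b(z,u,z) is absorbed, and b(u,z,z) = 0 has been dropped.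
  have hid : μ * (v' - v).gradNorm ^ 2 + porousForm α φ (v' - v) (v' - v) =
      viscousForm μ (u' - u) (v' - v) + porousForm α φ (u' - u) (v' - v) +
      weightedForm (fun x => α (φ'.val x) - α (φ.val x)) u' (v' - v) -
      weightedForm (fun x => α (φ'.val x) - α (φ.val x)) v' (v' - v) -
      trilinearForm (v' - v) (u' - u) v' - trilinearForm (v' - v) u (v' - v) -
      trilinearForm (u' - u) (v' - v) v' := by
    linarith only [m, m', ea, ea', eb1, eb2, eb3, eb4, eb5, ec, ec']
  linarith only [hid, b1, b2, b3, b4, b5, b6, b7, bp, hs]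

end Estimates

end PhaseFlow

end

/-! ### Choice of constants and conclusion -/

theorem lemma3p2 {d : ℕ} (hd : d = 2 ∨ d = 3) (Ω : Set (E d)) (hΩo : IsOpen Ω)
    (hΩb : Bornology.IsBounded Ω) (hΩn : Ω.Nonempty) :
    (∃ Cp : ℝ, IsPoincareConstant Ω Cp) ∧
    ∀ (μ α₀ : ℝ) (f : E d → E d), 0 < μ → 0 < α₀ → MemLp f 2 (volume.restrict Ω) →
    ∃ C₁ C₂ : ℝ, 0 < C₁ ∧ 0 < C₂ ∧
    ∀ (α : ℝ → ℝ) (γ Cp : ℝ), (∀ s, 0 ≤ α s ∧ α s ≤ α₀) → 0 < γ → IsL2Lipschitz Ω α γ →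
      IsPoincareConstant Ω Cp →
    ∀ (φ φ' : H1 Ω ℝ) (u u' : H1 Ω (E d)) (p p' : E d → ℝ),
      MemLp φ.val ⊤ (volume.restrict Ω) → MemLp φ'.val ⊤ (volume.restrict Ω) →
      IsStateSolution μ f α φ u p → IsStateSolution μ f α φ' u' p' →
      u.gradNorm ≤ μ / (2 * K Ω) → u'.gradNorm ≤ μ / (2 * K Ω) →
      u.norm ≤ C₁ ∧ u'.norm ≤ C₁ ∧
      (u' - u).gradNorm ≤ lipState Ω γ Cp * l2norm Ω (φ' - φ).val ∧
      ∀ (v v' : H1 Ω (E d)) (q q' : E d → ℝ),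
        IsAdjointSolution μ α φ u v q → IsAdjointSolution μ α φ' u' v' q' →
        v.norm ≤ C₂ ∧ v'.norm ≤ C₂ ∧
        (v' - v).gradNorm ≤ lipAdjoint Ω μ α₀ γ Cp C₁ C₂ * l2norm Ω (φ' - φ).val ∧
        ∀ B₁ B₂ : ℝ, u'.gradNorm ≤ B₁ → v'.gradNorm ≤ B₂ →
          (v' - v).gradNorm ≤ lipAdjointSum Ω μ α₀ γ Cp B₁ B₂ * l2norm Ω (φ' - φ).val := by
  have hex := exists_isPoincareConstant hd hΩo hΩb hΩn
  refine ⟨hex, fun μ α₀ f hμ hα₀ _ => ?_⟩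
  obtain ⟨P, hP⟩ := hex
  have hK := K_pos hΩo hΩb hΩn
  have hP0 := hP.1
  -- `Bu` and `Bv` bound the gradients of states and adjoints. `M` is the three-term sum of the
  -- adjoint difference estimate, taken at these bounds and divided by γ(1+C_p)². All use the fixed
  -- Poincaré constant P, so they depend neither on γ nor on the given C_p.
  set Bu := μ / (2 * K Ω) with hBu
  set Bv := (μ + α₀ * P ^ 2) / K Ω with hBv
  set M := 2 * Bv + (Bu + Bv) + (α₀ * P ^ 2 + μ) / K Ω with hM
  have hBu0 : 0 < Bu := by positivity
  have hBv0 : 0 < Bv := by positivity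
  have hM0 : 0 < M := by positivity
  -- The summand `M / μ` is not needed to bound the adjoints; it makes 2K_Ω C̃₁ 𝒞₂ = 2γ(1+C_p)² 𝒞₂
  -- at least (2/μ) γ(1+C_p)² M.
  refine ⟨(P + 1) * Bu, (P + 1) * Bv + M / μ, by positivity, by positivity, ?_⟩
  intro α γ Cp hα hγ hLip hCp φ φ' u u' p p' hφ hφ' hu hu' hs hs'
  have hCp0 := hCp.1
  have hm := aestronglyMeasurable_comp_of_isL2Lipschitz hΩo hΩb hΩn hγ.le hLip φ
  have hm' := aestronglyMeasurable_comp_of_isL2Lipschitz hΩo hΩb hΩn hγ.le hLip φ'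
  have hδ := hLip φ φ' hφ hφ'
  set N := l2norm Ω (φ' - φ).val
  have hN : 0 ≤ N := l2norm_nonneg _
  have hsmall : ∀ w : H1 Ω (E d), w.gradNorm ≤ Bu → K Ω * w.gradNorm ≤ μ / 2 := fun w hw => by
    calc K Ω * w.gradNorm ≤ K Ω * Bu := mul_le_mul_of_nonneg_left hw hK.le
      _ = μ / 2 := by rw [hBu]; field_simp
  have hnorm : ∀ w : H1 Ω (E d), w.IsZeroBoundary → ∀ B, w.gradNorm ≤ B → w.norm ≤ (P + 1) * B :=
    fun w hw B hB => (H1.norm_le hP hw).trans (mul_le_mul_of_nonneg_left hB (by positivity))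
  have hstate : (u' - u).gradNorm ≤ lipState Ω γ Cp * N := by
    have h1 := hu.gradNorm_sub_le hd hΩb hCp hα hm hm' hu' (hsmall u' hs')
    have h2 : μ / 2 * (u' - u).gradNorm ≤ μ / 2 * (lipState Ω γ Cp * N) := by
      calc _ ≤ γ * N * (1 + Cp) ^ 2 * Bu := by
            refine h1.trans (mul_le_mul (mul_le_mul_of_nonneg_right hδ (by positivity)) hs'
              u'.gradNorm_nonneg (by positivity))
        _ = _ := by simp only [hBu, lipState]; field_simp
    exact le_of_mul_le_mul_left h2 (by positivity)
  refine ⟨hnorm u hu.boundary _ hs, hnorm u' hu'.boundary _ hs', hstate, ?_⟩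
  intro v v' q q' hv hv'
  have hadj : ∀ {φ : H1 Ω ℝ} {u v : H1 Ω (E d)} {p q : E d → ℝ},
      AEStronglyMeasurable (fun x => α (φ.val x)) (volume.restrict Ω) →
      IsStateSolution μ f α φ u p → IsAdjointSolution μ α φ u v q → u.gradNorm ≤ Bu →
      v.gradNorm ≤ Bv := fun hm hu hv hs => by
    have h1 := hv.gradNorm_le hd hΩb hP hμ hα hm hu.boundary hu.isSolenoidal (hsmall _ hs)
    refine le_of_mul_le_mul_left (a := μ / 2) (h1.trans ?_) (by positivity)
    calc _ ≤ (μ + α₀ * P ^ 2) * Bu := mul_le_mul_of_nonneg_left hs (by positivity)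
      _ = _ := by simp only [hBu, hBv]; field_simp
  have hvB := hadj hm hu hv hs
  have hvB' := hadj hm' hu' hv' hs'
  have hMμ : 0 ≤ M / μ := by positivity
  have hL : 0 ≤ lipState Ω γ Cp := by unfold lipState; positivity
  -- The Poincaré constant Q in the α₀ term is left free: Q = P for the maximum, where the bound
  -- must match `M`, and Q = C_p for the sum.
  have hdiff : ∀ Q, IsPoincareConstant Ω Q → ∀ B₁ B₂, u'.gradNorm ≤ B₁ → v'.gradNorm ≤ B₂ →
      μ / 2 * (v' - v).gradNorm ≤ (2 * K Ω * lipState Ω γ Cp * B₂ +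
        γ * (1 + Cp) ^ 2 * (B₁ + B₂) + (α₀ * Q ^ 2 + μ) * lipState Ω γ Cp) * N := by
    intro Q hQ B₁ B₂ h1 h2
    have h := hv.gradNorm_sub_le hd hΩb hQ hCp hμ hα hm hm' hu.boundary hu.isSolenoidal
      hu'.boundary hv' (hsmall u hs)
    have := u'.gradNorm_nonneg
    have := v'.gradNorm_nonneg
    refine h.trans ?_
    calc _ ≤ 2 * K Ω * (lipState Ω γ Cp * N) * B₂ + γ * N * (1 + Cp) ^ 2 * (B₁ + B₂) +
          (α₀ * Q ^ 2 + μ) * (lipState Ω γ Cp * N) := by gcongr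
      _ = _ := by ring
  refine ⟨(hnorm v hv.boundary _ hvB).trans (by linarith),
    (hnorm v' hv'.boundary _ hvB').trans (by linarith), ?_, fun B₁ B₂ h1 h2 => ?_⟩
  · have h := hdiff P hP Bu Bv hs' hvB'
    -- The first entry of the maximum suffices, by the choice of 𝒞₂.
    refine le_trans ?_ (mul_le_mul_of_nonneg_right (le_max_left _ _) hN)
    refine le_of_mul_le_mul_left (a := μ / 2) (h.trans ?_) (by positivity)
    have hKL : K Ω * lipState Ω γ Cp = γ * (1 + Cp) ^ 2 := by
      unfold lipState; field_simp
    have hKM : 2 * K Ω * lipState Ω γ Cp * Bv + γ * (1 + Cp) ^ 2 * (Bu + Bv) +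
        (α₀ * P ^ 2 + μ) * lipState Ω γ Cp = γ * (1 + Cp) ^ 2 * M := by
      rw [hM, lipState]; field_simp
    rw [hKM, ← mul_assoc]
    refine mul_le_mul_of_nonneg_right ?_ hN
    calc γ * (1 + Cp) ^ 2 * M = μ / 2 * (2 * (γ * (1 + Cp) ^ 2) * (M / μ)) := by field_simp
      _ ≤ μ / 2 * (2 * (γ * (1 + Cp) ^ 2) * ((P + 1) * Bv + M / μ)) := by
        gcongr
        have : 0 ≤ (P + 1) * Bv := by positivity
        linarith
      _ = _ := by rw [← hKL]; ring
  · have h := hdiff Cp hCp B₁ B₂ h1 h2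
    refine le_of_mul_le_mul_left (a := μ / 2) (h.trans (le_of_eq ?_)) (by positivity)
    unfold lipAdjointSum
    field_simp
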